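/- **Setting.** Write $f,g$ for spectral densities, i.e. nonnegative integrable functions on $(-\pi,\pi]$, of two uncorrelated stationary sequences $\xi,\eta$ (so that $\mathsf E\,\xi(m)\overline{\xi(n)}=\frac1{2\pi}\int_{-\pi}^{\pi} e^{i(m-n)\lambda}f(\lambda)\,d\lambda$, and likewise for $\eta$ and $g$). Let $a(k)\in\mathbb C$, $k\ge 0$, satisfy $\sum_k|a(k)|<\infty$ and $\sum_k (k+1)|a(k)|^2<\infty$, put $A(e^{i\lambda})=\sum_{k\ge0}a(k)e^{-i\lambda k}$, and consider the estimation of $A\xi=\sum_{k\ge0}a(k)\xi(-k)$ from the observations $\xi(m)+\eta(m)$, $m\le 0$. Let $L_2^0(f+g)$ be the closed span of $\{e^{im\lambda}:m\le 0\}$ in $L_2(f+g)$. The estimate with spectral characteristic $h\in L_2^0(f+g)$ has mean-square error $$\Delta(h;f,g)=\frac1{2\pi}\int_{-\pi}^{\pi}|A(e^{i\lambda})-h(\lambda)|^2f(\lambda)\,d\lambda+\frac1{2\pi}\int_{-\pi}^{\pi}|h(\lambda)|^2g(\lambda)\,d\lambda ,$$ and $\Delta(f,g)=\min_{h\in L_2^0(f+g)}\Delta(h;f,g)$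 is the error of the optimal linear estimate. The minimality condition is $\int_{-\pi}^{\pi}\frac{d\lambda}{f(\lambda)+g(\lambda)}<\infty$. Under the minimality condition define, for $k,j\ge0$, $$R_{k,j}=\frac1{2\pi}\int_{-\pi}^{\pi} e^{-i\lambda(j+k)}\frac{f}{f+g}\,d\lambda,\qquad P_{k,j}=\frac1{2\pi}\int_{-\pi}^{\pi} e^{i\lambda(j-k)}\frac{1}{f+g}\,d\lambda,\qquad Q_{k,j}=\frac1{2\pi}\int_{-\pi}^{\pi} e^{i\lambda(k-j)}\frac{fg}{f+g}\,d\lambda ,$$ $(Ra)_l=\sum_m R_{l+1,m}a(m)$ and $\langle Qa,a\rangle=\sum_{k,j}Q_{k,j}a(j)\overline{a(k)}$. The Toeplitz operator $P=(P_{l,k})$ acts on the sequences $c$ that are the coefficients of an integrable function $C(\lambda)$ with Fourier series $\sum_{k\ge0}c(k)e^{i\lambda(k+1)}$ and with finite energy $\langle Pc,c\rangle=\frac1{2\pi}\int_{-\pi}^{\pi}\frac{|C|^2}{f+g}\,d\lambda<\infty$; $(Pc)_l$ is the Fourier coefficient of $C/(f+g)$ at $l+1$ (for absolutely summable $c$ this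 is $\sum_kP_{l,k}c(k)$). By $c=P^{-1}Ra$ we mean $Pc=Ra$; then $\sum_k(P^{-1}Ra)_ke^{i\lambda(k+1)}$ denotes $C(\lambda)$, and $\langle Ra,P^{-1}Ra\rangle=\langle Pc,c\rangle$. Put $$h(f,g)(\lambda)=A(e^{i\lambda})\frac{f(\lambda)}{f(\lambda)+g(\lambda)}-\frac{\sum_{k}(P^{-1}Ra)_ke^{i\lambda(k+1)}}{f(\lambda)+g(\lambda)} .$$ For real numbers $P_1,P_2$ let $\mathcal D=\mathcal D_f^0\times\mathcal D_g^0$, where $\mathcal D_f^0$ is the set of spectral densities $f$ with $\frac1{2\pi}\int_{-\pi}^{\pi} f\,d\lambda\le P_1$ and $\mathcal D_g^0$ is the set of spectral densities $g$ with $\frac1{2\pi}\int_{-\pi}^{\pi} g\,d\lambda\le P_2$. A pair $(f^0,g^0)\in\mathcal D$ is *least favorable* in $\mathcal D$ if $\Delta(f^0,g^0)=\max_{(f,g)\in\mathcal D}\Delta(f,g)$. A function $h^0$ is *minimax-robust* if $h^0\in H_{\mathcal D}=\bigcap_{(f,g)\in\mathcal D}L_2^0(f+g)$ and $\sup_{(f,g)\in\mathcal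 D}\Delta(h^0;f,g)=\min_{h\in H_{\mathcal D}}\sup_{(f,g)\in\mathcal D}\Delta(h;f,g)$. **Theorem.** Let $f^0\in\mathcal D_f^0$, $g^0\in\mathcal D_g^0$ satisfy the minimality condition, let $P^0,R^0,Q^0$ be the corresponding $P,R,Q$, and suppose that the functions $$h_f=\frac{\bigl|A(e^{i\lambda})g^0+\sum_k((P^0)^{-1}R^0a)_ke^{i\lambda(k+1)}\bigr|}{f^0+g^0},\qquad h_g=\frac{\bigl|A(e^{i\lambda})f^0-\sum_k((P^0)^{-1}R^0a)_ke^{i\lambda(k+1)}\bigr|}{f^0+g^0}$$ are (essentially) bounded. Suppose that for some constants $\alpha_1,\alpha_2\ge0$, for almost all $\lambda$, $$\Bigl|A(e^{i\lambda})g^0(\lambda)+\sum_k((P^0)^{-1}R^0a)_ke^{i\lambda(k+1)}\Bigr|=\alpha_1\bigl(f^0(\lambda)+g^0(\lambda)\bigr),$$ $$\Bigl|A(e^{i\lambda})f^0(\lambda)-\sum_k((P^0)^{-1}R^0a)_ke^{i\lambda(k+1)}\Bigr|=\alpha_2\bigl(f^0(\lambda)+g^0(\lambda)\bigr),$$ and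 that $(f^0,g^0)$ solves the maximization problem $$\langle Ra,P^{-1}Ra\rangle+\langle Qa,a\rangle\to\max$$ over the pairs $(f,g)\in\mathcal D$ satisfying the minimality condition. Then $(f^0,g^0)$ is least favorable in $\mathcal D$ for the optimal linear filtering of $A\xi$, and $h(f^0,g^0)$ is the spectral characteristic of the optimal linear estimate for $(f^0,g^0)$ and is minimax-robust for $\mathcal D$. -/

import Mathlib

open MeasureTheory Set Filter Topology
open scoped Real ENNReal ComplexConjugate

noncomputable section

namespace RobustFiltering

/-- Lebesgue measure on the frequency interval. -/
def freq : Measure ℝ := volume.restrict (Ioc (-π) π)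

/-- The exponential `e^{i n t}`. -/
def expo (n : ℤ) (t : ℝ) : ℂ := Complex.exp ((n : ℂ) * (t : ℂ) * Complex.I)

/-- The Fourier coefficient `(1/2π) ∫ F(t) e^{-i n t} dt`. -/
def fourierCoef (F : ℝ → ℂ) (n : ℤ) : ℂ :=
  (1 / (2 * (π : ℂ))) * ∫ t, F t * expo (-n) t ∂freq

/-- A spectral density: a nonnegative integrable function on the frequency interval. -/
structure IsSpectralDensity (f : ℝ → ℝ) : Prop where
  integrable : Integrable f freq
  nonneg : ∀ᵐ t ∂freq, 0 ≤ f t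

/-- The minimality condition `∫ 1 / (f + g) < ∞`.  The inverse is taken in `[0, ∞]`, where
`0⁻¹ = ∞`, so that the condition forces `f + g > 0` almost everywhere. -/
def Minimality (f g : ℝ → ℝ) : Prop :=
  ∫⁻ t, (ENNReal.ofReal (f t + g t))⁻¹ ∂freq < ⊤

/-- The standing conditions on the coefficients of the functional `Aξ = ∑ a(k) ξ(-k)`. -/
structure AdmissibleCoeffs (a : ℕ → ℂ) : Prop where
  summable_norm : Summable fun k => ‖a k‖
  summable_sq : Summable fun k : ℕ => ((k : ℝ) + 1) * ‖a k‖ ^ 2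

/-- `A(e^{it}) = ∑ a(k) e^{-i k t}`. -/
def symbolA (a : ℕ → ℂ) (t : ℝ) : ℂ := ∑' k : ℕ, a k * expo (-(k : ℤ)) t

/-! ### The mean-square error of a linear estimate -/

/-- The spectral measure `f(t) dt / 2π`. -/
def specMeasure (f : ℝ → ℝ) : Measure ℝ :=
  freq.withDensity fun t => ENNReal.ofReal (f t / (2 * π))

/-- Linear combinations `∑ x(k) e^{-i k t}`, `k ≥ 0`, of the exponentials of the observations. -/
def trigPoly (x : ℕ →₀ ℂ) (t : ℝ) : ℂ := x.sum fun k z => z * expo (-(k : ℤ)) t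

/-- Membership in `L₂⁰(f + g)`, the closed span of `e^{i m t}`, `m = 0, -1, -2, …`,
in `L₂(f + g)`. -/
structure MemL20 (f g : ℝ → ℝ) (h : ℝ → ℂ) : Prop where
  memLp : MemLp h 2 (specMeasure (f + g))
  approx : ∀ ε : ℝ≥0∞, 0 < ε → ∃ x : ℕ →₀ ℂ,
    eLpNorm (fun t => h t - trigPoly x t) 2 (specMeasure (f + g)) < ε

/-- `Δ(h; f, g) = E|Aξ - Âξ|²` for the estimate `Âξ = ∫ h dZ_{ξ+η}` with spectral
characteristic `h`, when `ξ` and `η` are uncorrelated and have spectral densities `f`, `g`: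
`(1/2π) ∫ |A - h|² f + (1/2π) ∫ |h|² g`.  See `sq_norm_sub_eq_mse`. -/
def mse (a : ℕ → ℂ) (h : ℝ → ℂ) (f g : ℝ → ℝ) : ℝ≥0∞ :=
  ∫⁻ t, ‖symbolA a t - h t‖ₑ ^ 2 ∂specMeasure f + ∫⁻ t, ‖h t‖ₑ ^ 2 ∂specMeasure g

/-- `Δ(f, g)`, the mean-square error of the optimal linear estimate. -/
def optimalError (a : ℕ → ℂ) (f g : ℝ → ℝ) : ℝ≥0∞ :=
  ⨅ h ∈ {h : ℝ → ℂ | MemL20 f g h}, mse a h f g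

/-- `h` is the spectral characteristic of the optimal linear estimate of `Aξ`. -/
def IsOptimalCharacteristic (a : ℕ → ℂ) (f g : ℝ → ℝ) (h : ℝ → ℂ) : Prop :=
  MemL20 f g h ∧ mse a h f g = optimalError a f g

/-! ### The operators `P`, `R`, `Q` -/

/-- `R_{k,j} = (1/2π) ∫ e^{-i t (j + k)} f / (f + g)`. -/
def entryR (f g : ℝ → ℝ) (k j : ℕ) : ℂ :=
  fourierCoef (fun t => ((f t / (f t + g t) : ℝ) : ℂ)) ((j : ℤ) + k)

/-- `P_{k,j} = (1/2π) ∫ e^{i t (j - k)} / (f + g)`. -/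
def entryP (f g : ℝ → ℝ) (k j : ℕ) : ℂ :=
  fourierCoef (fun t => ((1 / (f t + g t) : ℝ) : ℂ)) ((k : ℤ) - j)

/-- `Q_{k,j} = (1/2π) ∫ e^{i t (k - j)} f g / (f + g)`. -/
def entryQ (f g : ℝ → ℝ) (k j : ℕ) : ℂ :=
  fourierCoef (fun t => ((f t * g t / (f t + g t) : ℝ) : ℂ)) ((j : ℤ) - k)

/-- The vector `R a`, where `R` has the matrix `(R_{l+1,m})`. -/
def vecR (a : ℕ → ℂ) (f g : ℝ → ℝ) (l : ℕ) : ℂ := ∑' m : ℕ, entryR f g (l + 1) m * a m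

/-- The quadratic form `⟨Q a, a⟩`. -/
def formQ (a : ℕ → ℂ) (f g : ℝ → ℝ) : ℝ :=
  (∑' k : ℕ, (∑' j : ℕ, entryQ f g k j * a j) * conj (a k)).re

/-- `C` is the (integrable) function with Fourier series `∑ c(k) e^{i t (k+1)}`. -/
structure HasFourierSeries (C : ℝ → ℂ) (c : ℕ → ℂ) : Prop where
  integrable : Integrable C freq
  coef : ∀ k : ℕ, fourierCoef C ((k : ℤ) + 1) = c k
  coef_nonpos : ∀ n : ℤ, n ≤ 0 → fourierCoef C n = 0

/-- `c = P⁻¹ b`, together with the function `C(t) = ∑ c(k) e^{i t (k+1)}`.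

`P` is the Toeplitz operator with matrix `P_{l,k}`, that is, with symbol `1 / (f + g)`.  Its
symbol is in general only integrable, so `P` acts on the sequences `c` of finite energy
`⟨P c, c⟩ = (1/2π) ∫ |C|² / (f + g) < ∞`, and `(P c)_l` is the Fourier coefficient of
`C / (f + g)` at `l + 1`.  For absolutely summable `c` this is the matrix product
`∑ₖ P_{l,k} c(k)`; see `fourierCoef_div_eq_tsum`. -/
structure IsInverseImageP (f g : ℝ → ℝ) (b c : ℕ → ℂ) (C : ℝ → ℂ) : Prop where
  series : HasFourierSeries C c
  energy : Integrable (fun t => ‖C t‖ ^ 2 / (f t + g t)) freq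
  apply : ∀ l : ℕ, fourierCoef (fun t => C t / ((f t + g t : ℝ) : ℂ)) ((l : ℤ) + 1) = b l

/-- The quadratic form `⟨P c, c⟩` of `P` at `c`; it is `⟨R a, P⁻¹ R a⟩` when `P c = R a`.  For
absolutely summable `c` it is `∑ (P c)_l conj (c(l))`; see `formP_eq_tsum`. -/
def formP (f g : ℝ → ℝ) (C : ℝ → ℂ) : ℝ :=
  (1 / (2 * π)) * ∫ t, ‖C t‖ ^ 2 / (f t + g t) ∂freq

/-- The value `⟨R a, P⁻¹ R a⟩ + ⟨Q a, a⟩`, where `C` is the function of `P⁻¹ R a`. -/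
def errorValue (a : ℕ → ℂ) (f g : ℝ → ℝ) (C : ℝ → ℂ) : ℝ := formP f g C + formQ a f g

/-- `h(f, g) = A f / (f + g) - C / (f + g)`, where `C` is the function of `P⁻¹ R a`. -/
def characteristic (a : ℕ → ℂ) (f g : ℝ → ℝ) (C : ℝ → ℂ) (t : ℝ) : ℂ :=
  symbolA a t * ((f t / (f t + g t) : ℝ) : ℂ) - C t / ((f t + g t : ℝ) : ℂ)

/-- `h_f = |A g + C| / (f + g)`. -/
def hf (a : ℕ → ℂ) (f g : ℝ → ℝ) (C : ℝ → ℂ) (t : ℝ) : ℝ :=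
  ‖symbolA a t * (g t : ℂ) + C t‖ / (f t + g t)

/-- `h_g = |A f - C| / (f + g)`. -/
def hg (a : ℕ → ℂ) (f g : ℝ → ℝ) (C : ℝ → ℂ) (t : ℝ) : ℝ :=
  ‖symbolA a t * (f t : ℂ) - C t‖ / (f t + g t)

/-! ### Classes of densities, least favorable densities, minimax-robust characteristics -/

/-- The spectral densities of power at most `p`: `(1/2π) ∫ f ≤ p`. -/
def powerClass (p : ℝ) : Set (ℝ → ℝ) :=
  {f | IsSpectralDensity f ∧ (1 / (2 * π)) * ∫ t, f t ∂freq ≤ p}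

/-- `(f₀, g₀)`, with `P₀⁻¹ R₀ a` given by `C₀`, solves the problem of maximizing
`⟨R a, P⁻¹ R a⟩ + ⟨Q a, a⟩` over the pairs of the class that satisfy the minimality condition,
which is what makes the operators meaningful. -/
def SolvesMaximization (a : ℕ → ℂ) (D : Set ((ℝ → ℝ) × (ℝ → ℝ))) (f₀ g₀ : ℝ → ℝ)
    (C₀ : ℝ → ℂ) : Prop :=
  (f₀, g₀) ∈ D ∧ ∀ f g : ℝ → ℝ, (f, g) ∈ D → Minimality f g →
    ∀ (c : ℕ → ℂ) (C : ℝ → ℂ), IsInverseImageP f g (vecR a f g) c C →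
      errorValue a f g C ≤ errorValue a f₀ g₀ C₀

/-- `(f₀, g₀)` is least favorable in the class `D`: it maximizes the optimal error. -/
def IsLeastFavorable (a : ℕ → ℂ) (D : Set ((ℝ → ℝ) × (ℝ → ℝ))) (f₀ g₀ : ℝ → ℝ) : Prop :=
  (f₀, g₀) ∈ D ∧ ∀ f g : ℝ → ℝ, (f, g) ∈ D → optimalError a f g ≤ optimalError a f₀ g₀

/-- `H_D = ⋂_{(f,g) ∈ D} L₂⁰(f + g)`. -/
def admissibleCharacteristics (D : Set ((ℝ → ℝ) × (ℝ → ℝ))) : Set (ℝ → ℂ) :=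
  {h | ∀ f g : ℝ → ℝ, (f, g) ∈ D → MemL20 f g h}

/-- The largest error `sup_{(f,g) ∈ D} Δ(h; f, g)` of `h` over the class. -/
def worstError (a : ℕ → ℂ) (D : Set ((ℝ → ℝ) × (ℝ → ℝ))) (h : ℝ → ℂ) : ℝ≥0∞ :=
  ⨆ p ∈ D, mse a h p.1 p.2

/-- `h₀` is minimax-robust: it lies in `H_D` and has the least worst-case error there. -/
def IsMinimaxRobust (a : ℕ → ℂ) (D : Set ((ℝ → ℝ) × (ℝ → ℝ))) (h₀ : ℝ → ℂ) : Prop :=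
  h₀ ∈ admissibleCharacteristics D ∧
    ∀ h ∈ admissibleCharacteristics D, worstError a D h₀ ≤ worstError a D h

/-! ### Link with the processes and with the matrices -/

lemma norm_expo (n : ℤ) (t : ℝ) : ‖expo n t‖ = 1 := by
  have : (n : ℂ) * (t : ℂ) * Complex.I = ((n * t : ℝ) : ℂ) * Complex.I := by push_cast; ring
  rw [expo, this, Complex.norm_exp_ofReal_mul_I]

lemma expo_add (m n : ℤ) (t : ℝ) : expo (m + n) t = expo m t * expo n t := by
  simp only [expo, ← Complex.exp_add]; congr 1; push_cast; ring

lemma conj_expo (n : ℤ) (t : ℝ) : conj (expo n t) = expo (-n) t := by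
  simp only [expo, ← Complex.exp_conj]; congr 1; simp

lemma continuous_expo (n : ℤ) : Continuous (expo n) := by unfold expo; fun_prop

/-- `∑ₖ c(k) e^{i t (k+1)}` as a pointwise sum. -/
def seriesC (c : ℕ → ℂ) (t : ℝ) : ℂ := ∑' k : ℕ, c k * expo ((k : ℤ) + 1) t

lemma hasSum_seriesC {c : ℕ → ℂ} (hc : Summable fun k => ‖c k‖) (t : ℝ) :
    HasSum (fun k : ℕ => c k * expo ((k : ℤ) + 1) t) (seriesC c t) := by
  refine (Summable.of_norm ?_).hasSum
  simpa [norm_expo] using hc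

/-- Multiplication by an absolutely convergent trigonometric series under the integral. -/
lemma integral_mul_series {F : ℝ → ℂ} (hF : Integrable F freq) {c : ℕ → ℂ}
    (hc : Summable fun k => ‖c k‖) (e : ℕ → ℤ) :
    HasSum (fun k : ℕ => c k * ∫ t, F t * expo (e k) t ∂freq)
      (∫ t, F t * ∑' k : ℕ, c k * expo (e k) t ∂freq) := by
  have hmeas : ∀ k, Integrable (fun t => F t * (c k * expo (e k) t)) freq := fun k => by
    refine hF.mul_bdd (c := ‖c k‖) ?_ ?_
    · exact (continuous_const.mul (continuous_expo _)).aestronglyMeasurable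
    · exact Eventually.of_forall fun t => by simp [norm_expo]
  have key := hasSum_integral_of_summable_integral_norm (μ := freq) hmeas (by
    have : ∀ k, ∫ t, ‖F t * (c k * expo (e k) t)‖ ∂freq = (∫ t, ‖F t‖ ∂freq) * ‖c k‖ := by
      intro k
      rw [← integral_mul_const]
      simp [norm_expo]
    simp only [this]
    exact hc.mul_left _)
  have e1 : ∀ k, ∫ t, F t * (c k * expo (e k) t) ∂freq
      = c k * ∫ t, F t * expo (e k) t ∂freq := by
    intro k
    rw [← integral_const_mul]
    congr 1; funext t; ring
  simp only [e1, tsum_mul_left] at key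
  exact key

/-- On absolutely summable sequences, `P` is the multiplication by the matrix `(P_{l,k})`. -/
theorem fourierCoef_div_eq_tsum {f g : ℝ → ℝ}
    (hw : Integrable (fun t => ((1 / (f t + g t) : ℝ) : ℂ)) freq) {c : ℕ → ℂ}
    (hc : Summable fun k => ‖c k‖) (l : ℕ) :
    fourierCoef (fun t => seriesC c t / ((f t + g t : ℝ) : ℂ)) ((l : ℤ) + 1)
      = ∑' k : ℕ, entryP f g l k * c k := by
  have h1 := (integral_mul_series hw hc fun k => (k : ℤ) - l).tsum_eq
  have h2 : ∀ k : ℕ, entryP f g l k * c k = (1 / (2 * (π : ℂ))) *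
      (c k * ∫ t, ((1 / (f t + g t) : ℝ) : ℂ) * expo ((k : ℤ) - l) t ∂freq) := by
    intro k
    simp only [entryP, fourierCoef, neg_sub]; ring
  simp only [h2, tsum_mul_left, h1, fourierCoef]
  congr 2
  funext t
  have h3 : ∀ k : ℕ, c k * expo ((k : ℤ) - l) t
      = (c k * expo ((k : ℤ) + 1) t) * expo (-((l : ℤ) + 1)) t := by
    intro k
    rw [mul_assoc, ← expo_add]; congr 2; ring
  simp only [h3, tsum_mul_right]
  rw [seriesC]; push_cast; ring

/-- On absolutely summable sequences, `formP` is `∑ (P c)_l conj (c(l))`. -/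
theorem formP_eq_tsum {f g : ℝ → ℝ}
    (hw : Integrable (fun t => ((1 / (f t + g t) : ℝ) : ℂ)) freq) {c : ℕ → ℂ}
    (hc : Summable fun k => ‖c k‖) :
    (formP f g (seriesC c) : ℂ)
      = ∑' l : ℕ, (∑' k : ℕ, entryP f g l k * c k) * conj (c l) := by
  have hint : Integrable (fun t => seriesC c t / ((f t + g t : ℝ) : ℂ)) freq := by
    have hcont : Continuous (seriesC c) := by
      refine continuous_tsum (fun k => continuous_const.mul (continuous_expo _)) hc ?_
      intro k t; simp [norm_expo]
    have hb : ∀ t, ‖seriesC c t‖ ≤ ∑' k, ‖c k‖ := fun t => by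
      refine (norm_tsum_le_tsum_norm ?_).trans_eq ?_ <;> simp [norm_expo, hc]
    refine (hw.mul_bdd hcont.aestronglyMeasurable (Eventually.of_forall hb)).congr ?_
    refine Eventually.of_forall fun t => ?_
    push_cast; ring
  have hc' : Summable fun k => ‖conj (c k)‖ := by simpa using hc
  have h1 := (integral_mul_series hint hc' fun k => -((k : ℤ) + 1)).tsum_eq
  have h2 : ∀ l : ℕ, (∑' k : ℕ, entryP f g l k * c k) * conj (c l)
      = (1 / (2 * (π : ℂ))) * (conj (c l) *
        ∫ t, (seriesC c t / ((f t + g t : ℝ) : ℂ)) * expo (-((l : ℤ) + 1)) t ∂freq) := by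
    intro l
    rw [← fourierCoef_div_eq_tsum hw hc l, fourierCoef]; ring
  simp only [h2, tsum_mul_left, h1, formP]
  push_cast
  congr 1
  rw [← integral_complex_ofReal]
  congr 1
  funext t
  have h3 : ∑' k : ℕ, conj (c k) * expo (-((k : ℤ) + 1)) t = conj (seriesC c t) := by
    rw [seriesC, Complex.conj_tsum]
    simp [conj_expo]
  rw [h3, div_mul_eq_mul_div, Complex.mul_conj, Complex.normSq_eq_norm_sq]
  push_cast; ring

lemma ae_specMeasure {f : ℝ → ℝ} {p : ℝ → Prop} (h : ∀ t, p t) :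
    ∀ᵐ t ∂specMeasure f, p t := Eventually.of_forall h

lemma isFiniteMeasure_specMeasure {f : ℝ → ℝ} (hf : IsSpectralDensity f) :
    IsFiniteMeasure (specMeasure f) := by
  refine isFiniteMeasure_withDensity_ofReal ?_
  exact (hf.integrable.div_const _).2

lemma specMeasure_le {f g : ℝ → ℝ} (hf : ∀ᵐ t ∂freq, f t ≤ g t) :
    specMeasure f ≤ specMeasure g := by
  refine withDensity_mono ?_
  filter_upwards [hf] with t ht
  gcongr

lemma continuous_trigPoly (x : ℕ →₀ ℂ) : Continuous (trigPoly x) := by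
  unfold trigPoly Finsupp.sum
  exact continuous_finsetSum _ fun k _ => continuous_const.mul (continuous_expo _)

lemma memLp_trigPoly {f : ℝ → ℝ} (hf : IsSpectralDensity f) (x : ℕ →₀ ℂ) :
    MemLp (trigPoly x) 2 (specMeasure f) := by
  have := isFiniteMeasure_specMeasure hf
  refine MemLp.of_bound (continuous_trigPoly x).aestronglyMeasurable
    (∑ k ∈ x.support, ‖x k‖) (ae_specMeasure fun t => ?_)
  refine (norm_sum_le _ _).trans (Finset.sum_le_sum fun k _ => ?_)
  simp [norm_expo]

/-- The sequence `ξ` of a Hilbert space is stationary with spectral density `f`: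
`⟨ξ(m), ξ(n)⟩ = (1/2π) ∫ e^{i (m - n) t} f(t) dt`.  For `H = L²(Ω, P)` the left-hand side is the
covariance `E ξ(m) conj (ξ(n))`. -/
def HasSpectralDensity {H : Type*} [NormedAddCommGroup H] [InnerProductSpace ℂ H]
    (ξ : ℤ → H) (f : ℝ → ℝ) : Prop :=
  ∀ m n : ℤ, inner ℂ (ξ n) (ξ m) = fourierCoef (fun t => (f t : ℂ)) (n - m)

/-- The linear combination `∑ x(k) ξ(-k)`. -/
def linComb {H : Type*} [NormedAddCommGroup H] [InnerProductSpace ℂ H]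
    (ξ : ℤ → H) (x : ℕ →₀ ℂ) : H := x.sum fun k z => z • ξ (-(k : ℤ))

lemma enorm_linComb {H : Type*} [NormedAddCommGroup H] [InnerProductSpace ℂ H]
    {ξ : ℤ → H} {f : ℝ → ℝ} (hf : IsSpectralDensity f) (hξ : HasSpectralDensity ξ f)
    (x : ℕ →₀ ℂ) :
    ‖linComb ξ x‖ₑ ^ 2 = ∫⁻ t, ‖trigPoly x t‖ₑ ^ 2 ∂specMeasure f := by
  have hcf : ∀ n : ℤ, Integrable (fun t => (f t : ℂ) * expo n t) freq := fun n =>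
    hf.integrable.ofReal.mul_bdd (c := 1) (continuous_expo _).aestronglyMeasurable
      (Eventually.of_forall fun t => by simp [norm_expo])
  have hpt : ∀ t, ((f t / (2 * π) * ‖trigPoly x t‖ ^ 2 : ℝ) : ℂ)
      = ∑ k ∈ x.support, ∑ j ∈ x.support, (conj (x k) * x j * (1 / (2 * (π : ℂ)))) *
          ((f t : ℂ) * expo ((k : ℤ) - j) t) := by
    intro t
    have h1 : ((‖trigPoly x t‖ ^ 2 : ℝ) : ℂ)
        = ∑ k ∈ x.support, ∑ j ∈ x.support, conj (x k) * x j * expo ((k : ℤ) - j) t := by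
      rw [← Complex.normSq_eq_norm_sq, Complex.normSq_eq_conj_mul_self, trigPoly, Finsupp.sum,
        map_sum, Finset.sum_mul_sum]
      refine Finset.sum_congr rfl fun k _ => Finset.sum_congr rfl fun j _ => ?_
      rw [map_mul, conj_expo, neg_neg, sub_eq_add_neg, expo_add]; ring
    push_cast at h1 ⊢
    rw [h1, Finset.mul_sum]
    refine Finset.sum_congr rfl fun k _ => ?_
    rw [Finset.mul_sum]
    refine Finset.sum_congr rfl fun j _ => ?_
    ring
  have hreal : ‖linComb ξ x‖ ^ 2 = ∫ t, f t / (2 * π) * ‖trigPoly x t‖ ^ 2 ∂freq := by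
    have : ((‖linComb ξ x‖ ^ 2 : ℝ) : ℂ)
        = ((∫ t, f t / (2 * π) * ‖trigPoly x t‖ ^ 2 ∂freq : ℝ) : ℂ) := by
      rw [← integral_complex_ofReal]
      simp only [hpt]
      rw [integral_finsetSum _ fun k _ => integrable_finsetSum _ fun j _ =>
        (hcf _).const_mul _]
      push_cast
      have h0 := inner_self_eq_norm_sq_to_K (𝕜 := ℂ) (linComb ξ x)
      simp only [Complex.coe_algebraMap] at h0
      rw [← h0]
      rw [linComb, Finsupp.sum, sum_inner]
      refine Finset.sum_congr rfl fun k _ => ?_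
      rw [inner_sum]
      rw [integral_finsetSum _ fun j _ => (hcf _).const_mul _]
      refine Finset.sum_congr rfl fun j _ => ?_
      rw [integral_const_mul, inner_smul_left, inner_smul_right, hξ, fourierCoef]
      have : -(-(k : ℤ) - -(j : ℤ)) = (k : ℤ) - j := by ring
      rw [this]; ring
    exact_mod_cast this
  rw [specMeasure, lintegral_withDensity_eq_lintegral_mul₀
    (hf.integrable.div_const _).aestronglyMeasurable.aemeasurable.ennreal_ofReal
    ((continuous_trigPoly x).enorm.measurable.pow_const 2).aemeasurable]
  have h2 : ∫⁻ t, ((fun t => ENNReal.ofReal (f t / (2 * π))) * fun t => ‖trigPoly x t‖ₑ ^ 2) t ∂freq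
      = ∫⁻ t, ENNReal.ofReal (f t / (2 * π) * ‖trigPoly x t‖ ^ 2) ∂freq := by
    refine lintegral_congr_ae ?_
    filter_upwards [hf.nonneg] with t ht
    rw [ENNReal.ofReal_mul (by positivity), ENNReal.ofReal_pow (norm_nonneg _), ofReal_norm]
    rfl
  rw [h2, ← ofReal_integral_eq_lintegral_ofReal, ← hreal, ENNReal.ofReal_pow (norm_nonneg _),
    ofReal_norm]
  · have : Integrable (fun t => f t / (2 * π) * ‖trigPoly x t‖ ^ 2) freq := by
      refine (hf.integrable.div_const _).mul_bdd (c := (∑ k ∈ x.support, ‖x k‖) ^ 2)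
        ((continuous_trigPoly x).norm.pow 2).aestronglyMeasurable (Eventually.of_forall fun t => ?_)
      rw [norm_pow, norm_norm]
      gcongr
      refine (norm_sum_le _ _).trans (Finset.sum_le_sum fun k _ => ?_)
      simp [norm_expo]
    exact this
  · filter_upwards [hf.nonneg] with t ht
    positivity

lemma eLpNorm_two_sq {ν : Measure ℝ} (F : ℝ → ℂ) :
    eLpNorm F 2 ν ^ 2 = ∫⁻ t, ‖F t‖ₑ ^ 2 ∂ν := by
  have := eLpNorm_nnreal_pow_eq_lintegral (f := F) (μ := ν) (p := 2) (by norm_num)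
  simpa using this

lemma tendsto_eLpNorm_of_sub {ν : Measure ℝ} {F : ℕ → ℝ → ℂ} {G : ℝ → ℂ}
    (hF : ∀ n, AEStronglyMeasurable (F n) ν) (hG : AEStronglyMeasurable G ν)
    (h : Tendsto (fun n => eLpNorm (fun t => G t - F n t) 2 ν) atTop (𝓝 0)) :
    Tendsto (fun n => eLpNorm (F n) 2 ν) atTop (𝓝 (eLpNorm G 2 ν)) := by
  have up : ∀ n, eLpNorm (F n) 2 ν ≤ eLpNorm G 2 ν + eLpNorm (fun t => G t - F n t) 2 ν := by
    intro n
    have := eLpNorm_sub_le (μ := ν) (p := 2) hG (hG.sub (hF n)) (by norm_num)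
    rw [sub_sub_cancel] at this
    exact this
  have lo : ∀ n, eLpNorm G 2 ν - eLpNorm (fun t => G t - F n t) 2 ν ≤ eLpNorm (F n) 2 ν := by
    intro n
    rw [tsub_le_iff_right]
    have := eLpNorm_add_le (μ := ν) (p := 2) (hF n) (hG.sub (hF n)) (by norm_num)
    rw [add_sub_cancel] at this
    exact this
  refine tendsto_of_tendsto_of_tendsto_of_le_of_le ?_ ?_ lo up
  · have := ENNReal.Tendsto.sub (tendsto_const_nhds (x := eLpNorm G 2 ν) (f := atTop (α := ℕ))) h
      (Or.inr (by simp))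
    simpa using this
  · simpa using h.const_add (eLpNorm G 2 ν)

/-- Let `ξ`, `η` be uncorrelated stationary sequences with spectral densities `f`, `g`, and let
`Y` be the linear estimate with spectral characteristic `h`, that is, the limit of
`∑ x(k) (ξ(-k) + η(-k))` when `∑ x(k) e^{-i k t}` tends to `h` in `L₂(f + g)`.  Then
`‖Aξ - Y‖² = Δ(h; f, g)`. -/
theorem sq_norm_sub_eq_mse {H : Type*} [NormedAddCommGroup H] [InnerProductSpace ℂ H]
    [CompleteSpace H] {ξ η : ℤ → H} {f g : ℝ → ℝ} (hf : IsSpectralDensity f)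
    (hg : IsSpectralDensity g) (hξ : HasSpectralDensity ξ f) (hη : HasSpectralDensity η g)
    (horth : ∀ m n : ℤ, inner ℂ (ξ m) (η n) = 0)
    {a : ℕ → ℂ} (ha : AdmissibleCoeffs a) {h : ℝ → ℂ}
    (hh : MemLp h 2 (specMeasure (f + g))) {x : ℕ → ℕ →₀ ℂ}
    (hx : Tendsto (fun n => eLpNorm (fun t => h t - trigPoly (x n) t) 2 (specMeasure (f + g)))
      atTop (𝓝 0))
    {Y : H} (hY : Tendsto (fun n => linComb (fun m => ξ m + η m) (x n)) atTop (𝓝 Y)) :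
    ‖∑' k : ℕ, a k • ξ (-(k : ℤ)) - Y‖ₑ ^ 2 = mse a h f g := by
  have := isFiniteMeasure_specMeasure hf
  have lef : specMeasure f ≤ specMeasure (f + g) := specMeasure_le (by
    filter_upwards [hg.nonneg] with t ht
    simpa using ht)
  have leg : specMeasure g ≤ specMeasure (f + g) := specMeasure_le (by
    filter_upwards [hf.nonneg] with t ht
    simpa using ht)
  -- truncations of `a`
  let y : ℕ → ℕ →₀ ℂ := fun n => ∑ k ∈ Finset.range n, Finsupp.single k (a k)
  have hpoly_add : ∀ (u v : ℕ →₀ ℂ) t, trigPoly (u + v) t = trigPoly u t + trigPoly v t := by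
    intro u v t
    exact Finsupp.sum_add_index' (by simp) (by intros; ring)
  have hpoly_neg : ∀ (u : ℕ →₀ ℂ) t, trigPoly (-u) t = - trigPoly u t := by
    intro u t
    rw [eq_neg_iff_add_eq_zero, ← hpoly_add]; simp [trigPoly]
  have hcomb_add : ∀ (ζ : ℤ → H) (u v : ℕ →₀ ℂ),
      linComb ζ (u + v) = linComb ζ u + linComb ζ v := by
    intro ζ u v
    exact Finsupp.sum_add_index' (by simp) (by intros; rw [add_smul])
  have hcomb_neg : ∀ (ζ : ℤ → H) (u : ℕ →₀ ℂ), linComb ζ (-u) = - linComb ζ u := by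
    intro ζ u
    rw [eq_neg_iff_add_eq_zero, ← hcomb_add]; simp [linComb]
  have hy_poly : ∀ n t, trigPoly (y n) t = ∑ k ∈ Finset.range n, a k * expo (-(k : ℤ)) t := by
    intro n t
    induction n with
    | zero => simp [y, trigPoly]
    | succ n ih =>
      simp only [y, Finset.sum_range_succ] at ih ⊢
      rw [hpoly_add, ih]; simp [trigPoly]
  have hy_comb : ∀ n, linComb ξ (y n) = ∑ k ∈ Finset.range n, a k • ξ (-(k : ℤ)) := by
    intro n
    induction n with
    | zero => simp [y, linComb]
    | succ n ih =>
      simp only [y, Finset.sum_range_succ] at ih ⊢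
      rw [hcomb_add, ih]; simp [linComb]
  have hsplit : ∀ n, linComb (fun m => ξ m + η m) (x n) = linComb ξ (x n) + linComb η (x n) := by
    intro n
    simp [linComb, Finsupp.sum, Finset.sum_add_distrib]
  -- the Hilbert space side
  have hAsum : Summable fun k : ℕ => a k • ξ (-(k : ℤ)) := by
    refine Summable.of_norm ?_
    have hn : ∀ k : ℕ, ‖ξ (-(k : ℤ))‖ = ‖ξ 0‖ := by
      intro k
      have h1 := hξ (-(k : ℤ)) (-(k : ℤ))
      have h2 := hξ 0 0
      rw [sub_self] at h1 h2
      have h3 := h1.trans h2.symm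
      rw [inner_self_eq_norm_sq_to_K, inner_self_eq_norm_sq_to_K] at h3
      have h4 : ‖ξ (-(k : ℤ))‖ ^ 2 = ‖ξ 0‖ ^ 2 := by exact_mod_cast h3
      exact (pow_left_inj₀ (norm_nonneg _) (norm_nonneg _) two_ne_zero).1 h4
    simp only [norm_smul, hn]
    exact ha.summable_norm.mul_right _
  have hlim1 : Tendsto (fun n => ‖linComb ξ (y n) - linComb (fun m => ξ m + η m) (x n)‖ₑ ^ 2)
      atTop (𝓝 (‖∑' k : ℕ, a k • ξ (-(k : ℤ)) - Y‖ₑ ^ 2)) := by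
    have h1 := (hAsum.hasSum.tendsto_sum_nat).sub hY
    simp only [← hy_comb] at h1
    exact (ENNReal.continuous_pow 2).continuousAt.tendsto.comp h1.enorm
  -- the spectral side
  have hA_sum : ∀ t, HasSum (fun k : ℕ => a k * expo (-(k : ℤ)) t) (symbolA a t) := fun t =>
    (Summable.of_norm (by simpa [norm_expo] using ha.summable_norm)).hasSum
  have hA_cont : Continuous (symbolA a) := by
    refine continuous_tsum (fun k => continuous_const.mul (continuous_expo _)) ha.summable_norm ?_
    intro k t; simp [norm_expo]
  have hA_lim : Tendsto (fun n => eLpNorm (fun t => symbolA a t - trigPoly (y n) t) 2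
      (specMeasure f)) atTop (𝓝 0) := by
    have htail := tendsto_sum_nat_add fun k => ‖a k‖
    have hb : ∀ n t, ‖symbolA a t - trigPoly (y n) t‖ ≤ ∑' k, ‖a (k + n)‖ := by
      intro n t
      have h1 := (hA_sum t).summable.sum_add_tsum_nat_add n
      rw [hy_poly, symbolA, ← h1, add_sub_cancel_left]
      have h2 : Summable fun k => ‖a (k + n)‖ := (summable_nat_add_iff n).2 ha.summable_norm
      refine (norm_tsum_le_tsum_norm ?_).trans_eq ?_
      · simpa [norm_expo] using h2
      · simp [norm_expo]
    have hb2 : ∀ n, eLpNorm (fun t => symbolA a t - trigPoly (y n) t) 2 (specMeasure f)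
        ≤ (specMeasure f) univ ^ ((2 : ℝ≥0∞).toReal⁻¹) * ENNReal.ofReal (∑' k, ‖a (k + n)‖) :=
      fun n => eLpNorm_le_of_ae_bound (ae_specMeasure (hb n))
    refine tendsto_of_tendsto_of_tendsto_of_le_of_le tendsto_const_nhds ?_ (fun _ => bot_le) hb2
    have h3 := ENNReal.tendsto_ofReal htail
    rw [ENNReal.ofReal_zero] at h3
    have h4 := ENNReal.Tendsto.const_mul
      (a := (specMeasure f) univ ^ ((2 : ℝ≥0∞).toReal⁻¹)) h3 (Or.inr (by
        refine (ENNReal.rpow_lt_top_of_nonneg (by positivity) (measure_ne_top _ _)).ne))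
    simpa using h4
  have hlimf : Tendsto (fun n => eLpNorm (trigPoly (y n - x n)) 2 (specMeasure f)) atTop
      (𝓝 (eLpNorm (fun t => symbolA a t - h t) 2 (specMeasure f))) := by
    refine tendsto_eLpNorm_of_sub (fun n => (continuous_trigPoly _).aestronglyMeasurable)
      (hA_cont.aestronglyMeasurable.sub (hh.1.mono_measure lef)) ?_
    have hxf := tendsto_of_tendsto_of_tendsto_of_le_of_le tendsto_const_nhds hx
      (fun _ => bot_le) fun n => eLpNorm_mono_measure
        (fun t => h t - trigPoly (x n) t) (p := 2) lef
    have hs := hA_lim.add hxf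
    rw [add_zero] at hs
    refine tendsto_of_tendsto_of_tendsto_of_le_of_le tendsto_const_nhds hs
      (fun _ => bot_le) fun n => ?_
    have h5 := eLpNorm_sub_le (μ := specMeasure f) (p := 2)
      (hA_cont.aestronglyMeasurable.sub (continuous_trigPoly (y n)).aestronglyMeasurable)
      ((hh.1.mono_measure lef).sub (continuous_trigPoly (x n)).aestronglyMeasurable) (by norm_num)
    refine le_of_eq_of_le ?_ h5
    congr 1; funext t
    simp only [sub_eq_add_neg, hpoly_add, hpoly_neg, Pi.add_apply, Pi.neg_apply]; ring
  have hlimg : Tendsto (fun n => eLpNorm (trigPoly (x n)) 2 (specMeasure g)) atTop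
      (𝓝 (eLpNorm h 2 (specMeasure g))) := by
    refine tendsto_eLpNorm_of_sub (fun n => (continuous_trigPoly _).aestronglyMeasurable)
      (hh.1.mono_measure leg) ?_
    exact tendsto_of_tendsto_of_tendsto_of_le_of_le tendsto_const_nhds hx
      (fun _ => bot_le) fun n => eLpNorm_mono_measure _ leg
  have hlim2 := ((ENNReal.continuous_pow 2).continuousAt.tendsto.comp hlimf).add
    ((ENNReal.continuous_pow 2).continuousAt.tendsto.comp hlimg)
  simp only [Function.comp_def, eLpNorm_two_sq] at hlim2
  refine tendsto_nhds_unique (hlim1.congr fun n => ?_) hlim2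
  rw [← enorm_linComb hf hξ, ← enorm_linComb hg hη, hsplit]
  have h6 : linComb ξ (y n) - (linComb ξ (x n) + linComb η (x n))
      = linComb ξ (y n - x n) - linComb η (x n) := by
    rw [sub_eq_add_neg (y n), hcomb_add, hcomb_neg]; abel
  have h7 : inner ℂ (linComb ξ (y n - x n)) (linComb η (x n)) = 0 := by
    rw [linComb, linComb, Finsupp.sum, Finsupp.sum, sum_inner]
    refine Finset.sum_eq_zero fun k _ => ?_
    rw [inner_sum]
    refine Finset.sum_eq_zero fun j _ => ?_
    rw [inner_smul_left, inner_smul_right, horth, mul_zero, mul_zero]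
  have h8 := norm_sub_sq (𝕜 := ℂ) (linComb ξ (y n - x n)) (linComb η (x n))
  rw [h7, map_zero, mul_zero, sub_zero] at h8
  rw [h6]
  simp only [← ofReal_norm, ← ENNReal.ofReal_pow (norm_nonneg _)]
  rw [h8, ENNReal.ofReal_add (by positivity) (by positivity)]

end RobustFiltering

end

open RobustFiltering

noncomputable section

namespace RobustFiltering

/-! The theorem is a saddle point argument. For `h = h(f₀, g₀)` one has `A - h = (A g₀ + C₀) / (f₀ +
g₀)` and `h = (A f₀ - C₀) / (f₀ + g₀)`, so the two equations say that `|A - h| = α₁` and `|h| = α₂`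
almost everywhere. The error of `h` at any pair is therefore `α₁² p(f) + α₂² p(g)`, where `p`
denotes the power (`mse_of_norm_eq`). Both conclusions are formal once `h` is optimal for `(f₀,
g₀)`, `h` lies in every `L₂⁰(f + g)`, and `(f₀, g₀)` maximizes the error of `h` over the class.

Optimality. Completing the square (`mse_eq_smoothingError_add`) turns filtering into the projection
of `A f / (f + g)` onto `L₂⁰(f + g)`. The equation `P c = R a` says that `h(f, g)` has no positive
frequencies; the remainder `C / (f + g)` is orthogonal to the observations because `C` has only
positive ones. Pythagoras' theorem gives `IsInverseImageP.mse_eq_add`.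

Admissibility. `h` is bounded and has no positive frequencies. Its Fejér means are polynomials in
the observed exponentials, obey the same bound, and converge almost everywhere along a subsequence,
hence in every `L₂(f + g)` by dominated convergence (`memL20_of_bounded`).

Maximality. What is needed is that no power is left unused where the corresponding `αᵢ` is nonzero.
Let `u`, `v` be the unused powers and add white noises of these levels to `f₀`, `g₀`; the new pair
is still in the class. The error of its optimal characteristic `h'` is the error of `h` at `(f₀,
g₀)`, plus the squared distance from `h` to `h'`, plus the error of `h'` at `(u, v)`. Since `(f₀,
g₀)` solves the maximization problem, the last two terms vanish; so `h' = h` and `α₁² u + α₂² v = 0`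
(`mse_const_eq_zero`). The comparison needs `P⁻¹ R a` for the new pair, which
`exists_isInverseImageP` supplies. -/

/-! ### Fourier coefficients on the frequency interval -/

instance isFiniteMeasure_freq : IsFiniteMeasure freq := by
  unfold freq; infer_instance

lemma integral_expo (n : ℤ) : ∫ t, expo n t ∂freq = if n = 0 then 2 * (π : ℂ) else 0 := by
  rw [freq, ← intervalIntegral.integral_of_le (by linarith [Real.pi_pos])]
  split_ifs with hn
  · subst hn
    simp [expo]; ring
  · have hc : (n : ℂ) * Complex.I ≠ 0 := by simp [hn]
    have h1 : ∀ t : ℝ, expo n t = Complex.exp ((n : ℂ) * Complex.I * t) := fun t => by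
      rw [expo]; congr 1; ring
    simp only [h1]
    rw [integral_exp_mul_complex hc, div_eq_zero_iff]
    left
    rw [sub_eq_zero, Complex.exp_eq_exp_iff_exists_int]
    exact ⟨n, by push_cast; ring⟩

lemma integrable_mul_expo {F : ℝ → ℂ} (hF : Integrable F freq) (n : ℤ) :
    Integrable (fun t => F t * expo n t) freq :=
  hF.mul_bdd (c := 1) (continuous_expo _).aestronglyMeasurable
    (Eventually.of_forall fun t => by simp [norm_expo])

lemma integrable_expo (n : ℤ) : Integrable (expo n) freq := by
  simpa using integrable_mul_expo (integrable_const (1 : ℂ)) n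

lemma fourierCoef_congr {F G : ℝ → ℂ} (h : F =ᵐ[freq] G) (n : ℤ) :
    fourierCoef F n = fourierCoef G n := by
  unfold fourierCoef
  congr 1
  refine integral_congr_ae ?_
  filter_upwards [h] with t ht
  rw [ht]

lemma fourierCoef_expo (m n : ℤ) : fourierCoef (expo m) n = if m = n then 1 else 0 := by
  have hpi : (π : ℂ) ≠ 0 := by exact_mod_cast Real.pi_ne_zero
  simp only [fourierCoef, ← expo_add, integral_expo, ← sub_eq_add_neg, sub_eq_zero]
  split_ifs
  · field_simp
  · simp

/-! ### Fejér means and bounded functions without positive frequencies -/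

/-- The Fejér mean of order `N` of the Fourier series of `h`. -/
def fejerMean (h : ℝ → ℂ) (N : ℕ) (t : ℝ) : ℂ :=
  (N : ℂ)⁻¹ * ∑ i ∈ Finset.range N, ∑ l ∈ Finset.range N,
    fourierCoef h ((l : ℤ) - i) * expo ((l : ℤ) - i) t

/-- The Dirichlet-type sum whose square modulus is the Fejér kernel. -/
def analyticKernel (N : ℕ) (t s : ℝ) : ℂ :=
  ∑ l ∈ Finset.range N, expo l t * expo (-(l : ℤ)) s

lemma sq_norm_analyticKernel (N : ℕ) (t s : ℝ) :
    ((‖analyticKernel N t s‖ ^ 2 : ℝ) : ℂ) = ∑ i ∈ Finset.range N, ∑ l ∈ Finset.range N,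
      expo ((l : ℤ) - i) t * expo (-((l : ℤ) - i)) s := by
  rw [← Complex.normSq_eq_norm_sq, Complex.normSq_eq_conj_mul_self, analyticKernel, map_sum,
    Finset.sum_mul_sum]
  refine Finset.sum_congr rfl fun i _ => Finset.sum_congr rfl fun l _ => ?_
  have e1 : -((l : ℤ) - i) = -(l : ℤ) + i := by ring
  rw [map_mul, conj_expo, conj_expo, neg_neg, e1, sub_eq_add_neg, expo_add, expo_add]
  ring

lemma continuous_analyticKernel (N : ℕ) (t : ℝ) : Continuous (analyticKernel N t) :=
  continuous_finsetSum _ fun _ _ => continuous_const.mul (continuous_expo _)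

lemma norm_analyticKernel_le (N : ℕ) (t s : ℝ) : ‖analyticKernel N t s‖ ≤ N := by
  refine (norm_sum_le _ _).trans ?_
  simp [norm_expo]

lemma integral_sq_norm_analyticKernel (N : ℕ) (t : ℝ) :
    ∫ s, ‖analyticKernel N t s‖ ^ 2 ∂freq = 2 * π * N := by
  have : ((∫ s, ‖analyticKernel N t s‖ ^ 2 ∂freq : ℝ) : ℂ) = ((2 * π * N : ℝ) : ℂ) := by
    rw [← integral_complex_ofReal]
    simp only [sq_norm_analyticKernel]
    rw [integral_finsetSum _ fun k _ => integrable_finsetSum _ fun j _ =>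
      (integrable_expo _).const_mul _]
    have h1 : ∀ i ∈ Finset.range N, ∫ s, ∑ l ∈ Finset.range N,
        expo ((l : ℤ) - i) t * expo (-((l : ℤ) - i)) s ∂freq = 2 * (π : ℂ) := by
      intro i hi
      rw [integral_finsetSum _ fun j _ => (integrable_expo _).const_mul _]
      simp only [integral_const_mul, integral_expo, neg_sub, sub_eq_zero, Nat.cast_inj]
      simp only [mul_ite, mul_zero]
      rw [Finset.sum_ite_eq, if_pos hi]
      simp [expo]
    rw [Finset.sum_congr rfl h1]
    simp; ring
  exact_mod_cast this

/-- The weight `|analyticKernel|² / N` is the Fejér kernel; this form makes its positivity visible.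
-/
lemma fejerMean_eq_integral {h : ℝ → ℂ} (hh : Integrable h freq) (N : ℕ) (t : ℝ) :
    fejerMean h N t = (N : ℂ)⁻¹ * ((1 / (2 * (π : ℂ))) *
      ∫ s, h s * ((‖analyticKernel N t s‖ ^ 2 : ℝ) : ℂ) ∂freq) := by
  rw [fejerMean]
  congr 1
  simp only [sq_norm_analyticKernel, Finset.mul_sum]
  have h1 : ∀ i l : ℕ, Integrable
      (fun s => h s * (expo ((l : ℤ) - i) t * expo (-((l : ℤ) - i)) s)) freq := by
    intro i l
    refine ((integrable_mul_expo hh (-((l : ℤ) - i))).const_mul (expo ((l : ℤ) - i) t)).congr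
      (Eventually.of_forall fun s => ?_)
    simp only
    ring
  rw [integral_finsetSum _ fun k _ => integrable_finsetSum _ fun j _ => h1 _ _, Finset.mul_sum]
  refine Finset.sum_congr rfl fun i _ => ?_
  rw [integral_finsetSum _ fun j _ => h1 _ _, Finset.mul_sum]
  refine Finset.sum_congr rfl fun l _ => ?_
  rw [fourierCoef, mul_assoc]
  congr 1
  rw [← integral_mul_const]
  congr 1
  funext s
  ring

/-- For `N > 0` the Fejér kernel is nonnegative with mean 1, so averaging against it preserves
bounds. Partial sums of the Fourier series would not do, since they need not be uniformly bounded.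
-/
lemma norm_fejerMean_le {h : ℝ → ℂ} (hh : Integrable h freq) {M : ℝ} (hM : 0 ≤ M)
    (hb : ∀ᵐ t ∂freq, ‖h t‖ ≤ M) (N : ℕ) (t : ℝ) : ‖fejerMean h N t‖ ≤ M := by
  have hint : ‖∫ s, h s * ((‖analyticKernel N t s‖ ^ 2 : ℝ) : ℂ) ∂freq‖ ≤ M * (2 * π * N) := by
    rw [← integral_sq_norm_analyticKernel N t, ← integral_const_mul]
    refine norm_integral_le_of_norm_le ?_ ?_
    · refine Integrable.const_mul ?_ _
      refine Integrable.of_bound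
        ((continuous_analyticKernel N t).norm.pow 2).aestronglyMeasurable ((N : ℝ) ^ 2)
        (Eventually.of_forall fun s => ?_)
      rw [norm_pow, norm_norm]
      gcongr
      exact norm_analyticKernel_le N t s
    · filter_upwards [hb] with s hs
      rw [norm_mul, Complex.norm_real, Real.norm_of_nonneg (by positivity)]
      gcongr
  rw [fejerMean_eq_integral hh, norm_mul, norm_mul]
  have hpi := Real.pi_pos
  have e1 : ‖1 / (2 * (π : ℂ))‖ = 1 / (2 * π) := by
    simp [abs_of_pos hpi]
  rw [e1, norm_inv, Complex.norm_natCast]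
  rcases Nat.eq_zero_or_pos N with rfl | hN
  · simpa using hM
  · have hN' : (0 : ℝ) < N := by exact_mod_cast hN
    calc (N : ℝ)⁻¹ * (1 / (2 * π) * ‖∫ s, h s * ((‖analyticKernel N t s‖ ^ 2 : ℝ) : ℂ) ∂freq‖)
        ≤ (N : ℝ)⁻¹ * (1 / (2 * π) * (M * (2 * π * N))) := by gcongr
      _ = M := by field_simp

lemma continuous_fejerMean (h : ℝ → ℂ) (N : ℕ) : Continuous (fejerMean h N) :=
  continuous_const.mul (continuous_finsetSum _ fun _ _ => continuous_finsetSum _ fun _ _ =>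
    continuous_const.mul (continuous_expo _))

/-- Without positive frequencies only the terms with `l ≤ i` survive, and `k = i - l` turns the
inner sum into a one-sided partial sum. The mean is thus a combination of observed exponentials and
also a Cesàro mean, to which `L₂` convergence applies. -/
lemma fejerMean_eq_cesaro {h : ℝ → ℂ} (hh : ∀ n : ℤ, 1 ≤ n → fourierCoef h n = 0)
    (N : ℕ) (t : ℝ) :
    fejerMean h N t = (N : ℂ)⁻¹ * ∑ i ∈ Finset.range N, ∑ k ∈ Finset.range (i + 1),
      fourierCoef h (-(k : ℤ)) * expo (-(k : ℤ)) t := by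
  rw [fejerMean]
  congr 1
  refine Finset.sum_congr rfl fun i hi => ?_
  rw [← Finset.sum_range_reflect _ (i + 1)]
  symm
  refine Finset.sum_subset_zero_on_sdiff
    (Finset.range_subset_range.2 (Finset.mem_range.1 hi)) ?_ ?_
  · intro l hl
    simp only [Finset.mem_sdiff, Finset.mem_range, not_lt] at hl
    rw [hh _ (by omega), zero_mul]
  · intro l hl
    rw [Finset.mem_range] at hl
    have : -(((i + 1 - 1 - l : ℕ)) : ℤ) = (l : ℤ) - i := by omega
    rw [this]

lemma exists_fejerMean_eq_trigPoly {h : ℝ → ℂ} (hh : ∀ n : ℤ, 1 ≤ n → fourierCoef h n = 0)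
    (N : ℕ) : ∃ x : ℕ →₀ ℂ, fejerMean h N = trigPoly x := by
  refine ⟨(N : ℂ)⁻¹ • ∑ i ∈ Finset.range N, ∑ k ∈ Finset.range (i + 1),
      Finsupp.single k (fourierCoef h (-(k : ℤ))), ?_⟩
  funext t
  let T : (ℕ →₀ ℂ) →ₗ[ℂ] ℂ := Finsupp.lsum ℂ fun k => (LinearMap.mulRight ℂ (expo (-(k : ℤ)) t))
  have hT : ∀ x, trigPoly x t = T x := fun x => rfl
  rw [hT, map_smul, map_sum, fejerMean_eq_cesaro hh]
  simp [T, Finsupp.lsum_single]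

lemma fourierCoeff_liftIoc_eq_fourierCoef [Fact (0 < 2 * π)] (h : ℝ → ℂ) (n : ℤ) :
    fourierCoeff (AddCircle.liftIoc (2 * π) (-π) h) n = fourierCoef h n := by
  have e : -π + 2 * π = π := by ring
  rw [fourierCoeff_eq_intervalIntegral _ _ (-π), e, fourierCoef, freq,
    intervalIntegral.integral_of_le (by linarith [Real.pi_pos]), Complex.real_smul]
  push_cast
  congr 1
  refine setIntegral_congr_fun measurableSet_Ioc fun t ht => ?_
  rw [AddCircle.liftIoc_coe_apply (by rwa [e]), fourier_coe_apply, smul_eq_mul, mul_comm, expo]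
  congr 2
  have hpi : (π : ℂ) ≠ 0 := by exact_mod_cast Real.pi_ne_zero
  push_cast
  field_simp


/-- On the circle the Fourier series converges in `L₂`, and Cesàro means inherit the limit. -/
lemma tendsto_eLpNorm_sub_fejerMean {h : ℝ → ℂ} (hm : MemLp h 2 freq)
    (hh : ∀ n : ℤ, 1 ≤ n → fourierCoef h n = 0) :
    Tendsto (fun N => eLpNorm (fun t => fejerMean h N t - h t) 2 freq) atTop (𝓝 0) := by
  have : Fact (0 < 2 * π) := ⟨by positivity⟩
  have e : -π + 2 * π = π := by ring
  have hpi : (π : ℂ) ≠ 0 := by exact_mod_cast Real.pi_ne_zero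
  have hmp := AddCircle.measurePreserving_mk (2 * π) (-π)
  rw [e] at hmp
  change MeasurePreserving ((↑) : ℝ → AddCircle (2 * π)) freq volume at hmp
  have hF : MemLp (AddCircle.liftIoc (2 * π) (-π) h) 2 (volume : Measure (AddCircle (2 * π))) := by
    refine MemLp.memLp_liftIoc ?_
    rw [e]; exact hm
  have hF' := memLp_haarAddCircle_iff.2 hF
  set F : Lp ℂ 2 (AddCircle.haarAddCircle (T := 2 * π)) := hF'.toLp _ with hFdef
  have hcoef : ∀ n, fourierCoeff F n = fourierCoef h n := fun n => by
    rw [fourierCoeff_congr_ae hF'.coeFn_toLp, fourierCoeff_liftIoc_eq_fourierCoef]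
  have hsum := hasSum_fourier_series_L2 F
  simp only [hcoef] at hsum
  have hinj : Function.Injective fun k : ℕ => -(k : ℤ) := fun a b hab => by simpa using hab
  -- The series over `ℤ` reduces to the frequencies `-k`, `k ≥ 0`, where the order of summation is
  -- the natural one.
  rw [← hinj.hasSum_iff] at hsum
  swap
  · intro n hn
    rw [hh n, zero_smul]
    by_contra hlt
    exact hn ⟨n.natAbs, by simp only; omega⟩
  have hces := ((tendsto_add_atTop_iff_nat 1).2 hsum.tendsto_sum_nat).cesaro_smul
  let G : ℕ → C(AddCircle (2 * π), ℂ) := fun N => ((N : ℝ)⁻¹ : ℂ) • ∑ i ∈ Finset.range N,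
    ∑ k ∈ Finset.range (i + 1), fourierCoef h (-(k : ℤ)) • fourier (-(k : ℤ))
  have hG : ∀ N (t : ℝ), G N t = fejerMean h N t := by
    intro N t
    rw [fejerMean_eq_cesaro hh]
    simp only [G, ContinuousMap.smul_apply, ContinuousMap.sum_apply, fourier_coe_apply,
      smul_eq_mul, expo]
    push_cast
    congr 1
    refine Finset.sum_congr rfl fun i _ => Finset.sum_congr rfl fun k _ => ?_
    congr 2
    field_simp
  have hGL : ∀ N : ℕ, (N⁻¹ : ℝ) • ∑ i ∈ Finset.range N, ∑ k ∈ Finset.range (i + 1),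
      ((fun n : ℤ => fourierCoef h n • fourierLp (T := 2 * π) 2 n) ∘ fun k : ℕ => -(k : ℤ)) k
      = ContinuousMap.toLp 2 AddCircle.haarAddCircle ℂ (G N) := by
    intro N
    rw [RCLike.real_smul_eq_coe_smul (K := ℂ)]
    simp only [G, map_smul, map_sum, Function.comp_apply, fourierLp]
    push_cast
    rfl
  simp only [hGL] at hces
  rw [hFdef, Lp.tendsto_Lp_iff_tendsto_eLpNorm _ _ hF'] at hces
  -- Haar measure on the circle has mass 1 and `freq` has mass `2π`, hence the constant factor.
  have hvol : ∀ N, eLpNorm (fun t => fejerMean h N t - h t) 2 freq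
      = ENNReal.ofReal (2 * π) ^ (1 / (2 : ℝ≥0∞)).toReal *
        eLpNorm (⇑(ContinuousMap.toLp 2 AddCircle.haarAddCircle ℂ (G N))
          - AddCircle.liftIoc (2 * π) (-π) h) 2 AddCircle.haarAddCircle := by
    intro N
    have h1 : ⇑(ContinuousMap.toLp 2 AddCircle.haarAddCircle ℂ (G N))
          - AddCircle.liftIoc (2 * π) (-π) h =ᵐ[AddCircle.haarAddCircle]
        ⇑(G N) - AddCircle.liftIoc (2 * π) (-π) h :=
      (ContinuousMap.coeFn_toLp AddCircle.haarAddCircle (G N)).sub EventuallyEq.rfl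
    rw [eLpNorm_congr_ae h1, ← smul_eq_mul,
      ← eLpNorm_smul_measure_of_ne_zero (by simpa using Real.pi_pos),
      ← AddCircle.volume_eq_smul_haarAddCircle, ← eLpNorm_comp_measurePreserving
        ((G N).continuous.aestronglyMeasurable.sub hF.1) hmp]
    refine eLpNorm_congr_ae ?_
    filter_upwards [ae_restrict_mem (μ := volume) (measurableSet_Ioc (a := -π) (b := π))] with t ht
    simp only [Function.comp_apply, Pi.sub_apply, hG]
    rw [AddCircle.liftIoc_coe_apply (by rwa [e])]
  simp only [hvol]
  have := ENNReal.Tendsto.const_mul (a := ENNReal.ofReal (2 * π) ^ (1 / (2 : ℝ≥0∞)).toReal) hces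
    (Or.inr (by finiteness))
  simpa using this

/-- A bounded function whose Fourier series contains no positive frequencies belongs to
`L₂⁰(f + g)` for all spectral densities. -/
lemma memL20_of_bounded {f g : ℝ → ℝ} (hf : IsSpectralDensity f) (hg : IsSpectralDensity g)
    {h : ℝ → ℂ} (hm : AEStronglyMeasurable h freq) {M : ℝ} (hb : ∀ᵐ t ∂freq, ‖h t‖ ≤ M)
    (hh : ∀ n : ℤ, 1 ≤ n → fourierCoef h n = 0) : MemL20 f g h := by
  wlog hM : 0 ≤ M generalizing M
  · exact this (M := max M 0) (hb.mono fun t ht => ht.trans (le_max_left _ _)) (le_max_right _ _)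
  have hfg : IsSpectralDensity (f + g) := ⟨hf.integrable.add hg.integrable, by
    filter_upwards [hf.nonneg, hg.nonneg] with t h1 h2
    exact add_nonneg h1 h2⟩
  have := isFiniteMeasure_specMeasure hfg
  have hac : specMeasure (f + g) ≪ freq := withDensity_absolutelyContinuous _ _
  have hL2 : MemLp h 2 freq := MemLp.of_bound hm M hb
  refine ⟨MemLp.of_bound (hm.mono_ac hac) M (hac.ae_le hb), fun ε hε => ?_⟩
  -- As `f + g` may be unbounded, convergence in `L₂(freq)` does not give convergence in `L₂(f +
  -- g)`. Almost everywhere convergence does pass to the absolutely continuous spectral measure,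
  -- where the constant `2M` dominates.
  obtain ⟨ns, -, hns⟩ := (tendstoInMeasure_of_tendsto_eLpNorm two_ne_zero
    (fun N => (continuous_fejerMean h N).aestronglyMeasurable) hm
    (tendsto_eLpNorm_sub_fejerMean hL2 hh)).exists_seq_tendsto_ae
  have hlim : Tendsto (fun i => ∫⁻ t, ‖h t - fejerMean h (ns i) t‖ₑ ^ 2 ∂specMeasure (f + g))
      atTop (𝓝 0) := by
    have h0 : ∫⁻ _, (0 : ℝ≥0∞) ∂specMeasure (f + g) = 0 := lintegral_zero
    rw [← h0]
    refine tendsto_lintegral_of_dominated_convergence' (fun _ => ENNReal.ofReal (2 * M) ^ 2)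
      (fun i => ?_) (fun i => ?_) ?_ ?_
    · exact (((hm.mono_ac hac).sub
        (continuous_fejerMean h (ns i)).aestronglyMeasurable).enorm).pow_const 2
    · filter_upwards [hac.ae_le hb] with t ht
      gcongr
      rw [← ofReal_norm]
      refine ENNReal.ofReal_le_ofReal ((norm_sub_le _ _).trans ?_)
      linarith [norm_fejerMean_le (hL2.integrable (by norm_num)) hM hb (ns i) t]
    · rw [lintegral_const]
      finiteness
    · filter_upwards [hac.ae_le hns] with t ht
      have h1 := (tendsto_const_nhds (x := h t)).sub ht
      rw [sub_self] at h1
      have h2 := (ENNReal.continuous_pow 2).continuousAt.tendsto.comp h1.enorm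
      simpa [Function.comp_def] using h2
  obtain ⟨i, hi⟩ := (hlim.eventually_lt_const (show 0 < ε ^ 2 by positivity)).exists
  obtain ⟨x, hx⟩ := exists_fejerMean_eq_trigPoly hh (ns i)
  refine ⟨x, ?_⟩
  rw [← eLpNorm_two_sq, hx] at hi
  exact lt_of_pow_lt_pow_left' 2 hi

/-! ### Spectral measures and the minimality condition -/

lemma IsSpectralDensity.add {f g : ℝ → ℝ} (hf : IsSpectralDensity f) (hg : IsSpectralDensity g) :
    IsSpectralDensity (f + g) :=
  ⟨hf.integrable.add hg.integrable, by
    filter_upwards [hf.nonneg, hg.nonneg] with t h1 h2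
    exact add_nonneg h1 h2⟩

lemma IsSpectralDensity.aemeasurable {f : ℝ → ℝ} (hf : IsSpectralDensity f) :
    AEMeasurable f freq := hf.integrable.aestronglyMeasurable.aemeasurable

lemma IsSpectralDensity.aemeasurable_density {f : ℝ → ℝ} (hf : IsSpectralDensity f) :
    AEMeasurable (fun t => ENNReal.ofReal (f t / (2 * π))) freq :=
  (hf.aemeasurable.div_const _).ennreal_ofReal

lemma specMeasure_absolutelyContinuous (f : ℝ → ℝ) : specMeasure f ≪ freq :=
  withDensity_absolutelyContinuous _ _

lemma lintegral_specMeasure {f : ℝ → ℝ} (hf : IsSpectralDensity f) {F : ℝ → ℝ≥0∞}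
    (hF : AEMeasurable F freq) :
    ∫⁻ t, F t ∂specMeasure f = ∫⁻ t, ENNReal.ofReal (f t / (2 * π)) * F t ∂freq :=
  lintegral_withDensity_eq_lintegral_mul₀ hf.aemeasurable_density hF

lemma lintegral_sq_specMeasure {f : ℝ → ℝ} (hf : IsSpectralDensity f) {F : ℝ → ℂ}
    (hF : AEStronglyMeasurable F freq) :
    ∫⁻ t, ‖F t‖ₑ ^ 2 ∂specMeasure f
      = ∫⁻ t, ENNReal.ofReal (f t / (2 * π) * ‖F t‖ ^ 2) ∂freq := by
  rw [lintegral_specMeasure hf (hF.enorm.pow_const 2)]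
  refine lintegral_congr_ae ?_
  filter_upwards [hf.nonneg] with t ht
  rw [ENNReal.ofReal_mul (by positivity), ENNReal.ofReal_pow (norm_nonneg _), ofReal_norm]

lemma integral_specMeasure {f : ℝ → ℝ} (hf : IsSpectralDensity f) (F : ℝ → ℂ) :
    ∫ t, F t ∂specMeasure f = (1 / (2 * (π : ℂ))) * ∫ t, F t * (f t : ℂ) ∂freq := by
  rw [specMeasure, integral_withDensity_eq_integral_toReal_smul₀ hf.aemeasurable_density
    (Eventually.of_forall fun _ => ENNReal.ofReal_lt_top), ← integral_const_mul]
  refine integral_congr_ae ?_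
  filter_upwards [hf.nonneg] with t ht
  rw [ENNReal.toReal_ofReal (by positivity), Complex.real_smul]
  push_cast; ring

lemma memLp_specMeasure_iff {f : ℝ → ℝ} (hf : IsSpectralDensity f) {F : ℝ → ℂ}
    (hF : AEStronglyMeasurable F freq) :
    MemLp F 2 (specMeasure f) ↔ Integrable (fun t => f t * ‖F t‖ ^ 2) freq := by
  rw [memLp_two_iff_integrable_sq_norm (hF.mono_ac (specMeasure_absolutelyContinuous f)),
    specMeasure, integrable_withDensity_iff_integrable_smul₀' hf.aemeasurable_density
    (Eventually.of_forall fun _ => ENNReal.ofReal_lt_top)]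
  have hpi := Real.pi_pos
  have h1 : (fun t => (ENNReal.ofReal (f t / (2 * π))).toReal • ‖F t‖ ^ 2) =ᵐ[freq]
      fun t => (2 * π)⁻¹ * (f t * ‖F t‖ ^ 2) := by
    filter_upwards [hf.nonneg] with t ht
    rw [ENNReal.toReal_ofReal (by positivity), smul_eq_mul]
    ring
  rw [integrable_congr h1, integrable_const_mul_iff (by simp [hpi.ne'])]

lemma Minimality.pos {f g : ℝ → ℝ} (hf : IsSpectralDensity f) (hg : IsSpectralDensity g)
    (hmin : Minimality f g) : ∀ᵐ t ∂freq, 0 < f t + g t := by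
  have h1 := ae_lt_top' ((hf.add hg).aemeasurable.ennreal_ofReal.inv) hmin.ne
  filter_upwards [h1] with t ht
  simpa using ht

lemma Minimality.integrable {f g : ℝ → ℝ} (hf : IsSpectralDensity f) (hg : IsSpectralDensity g)
    (hmin : Minimality f g) : Integrable (fun t => 1 / (f t + g t)) freq := by
  have hm : AEMeasurable (fun t => 1 / (f t + g t)) freq :=
    (hf.add hg).aemeasurable.const_div 1
  refine ⟨hm.aestronglyMeasurable, ?_⟩
  refine lt_of_eq_of_lt (lintegral_congr_ae ?_) hmin
  filter_upwards [hmin.pos hf hg] with t ht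
  rw [Real.enorm_of_nonneg (by positivity), one_div, ENNReal.ofReal_inv_of_pos ht]

/-- The density `f + g` is positive almost everywhere, so both measures have the same null sets;
equalities and measurability in `L₂(f + g)` can then be read on the frequency interval. -/
lemma Minimality.absolutelyContinuous {f g : ℝ → ℝ} (hf : IsSpectralDensity f)
    (hg : IsSpectralDensity g) (hmin : Minimality f g) : freq ≪ specMeasure (f + g) := by
  refine withDensity_absolutelyContinuous' (hf.add hg).aemeasurable_density ?_
  filter_upwards [hmin.pos hf hg] with t ht
  have hpi := Real.pi_pos
  simp only [ne_eq, ENNReal.ofReal_eq_zero, not_le, Pi.add_apply]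
  positivity

/-! ### The transfer function -/

lemma continuous_symbolA {a : ℕ → ℂ} (ha : AdmissibleCoeffs a) : Continuous (symbolA a) := by
  refine continuous_tsum (fun k => continuous_const.mul (continuous_expo _)) ha.summable_norm ?_
  intro k t; simp [norm_expo]

lemma norm_symbolA_le {a : ℕ → ℂ} (ha : AdmissibleCoeffs a) (t : ℝ) :
    ‖symbolA a t‖ ≤ ∑' k, ‖a k‖ := by
  refine (norm_tsum_le_tsum_norm ?_).trans_eq ?_ <;> simp [norm_expo, ha.summable_norm]

/-- The characteristic `A f / (f + g)` of the optimal estimate from the whole trajectory. -/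
def smoother (a : ℕ → ℂ) (f g : ℝ → ℝ) (t : ℝ) : ℂ :=
  symbolA a t * ((f t / (f t + g t) : ℝ) : ℂ)

lemma aestronglyMeasurable_smoother {a : ℕ → ℂ} (ha : AdmissibleCoeffs a) {f g : ℝ → ℝ}
    (hf : IsSpectralDensity f) (hg : IsSpectralDensity g) :
    AEStronglyMeasurable (smoother a f g) freq :=
  (continuous_symbolA ha).aestronglyMeasurable.mul
    (Complex.measurable_ofReal.comp_aemeasurable
      (hf.aemeasurable.div (hf.add hg).aemeasurable)).aestronglyMeasurable

lemma ratio_mem_Icc {x y : ℝ} (hx : 0 ≤ x) (hy : 0 ≤ y) : x / (x + y) ∈ Icc (0 : ℝ) 1 :=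
  ⟨by positivity, div_le_one_of_le₀ (by linarith) (by linarith)⟩

lemma norm_smoother_le {a : ℕ → ℂ} (ha : AdmissibleCoeffs a) {f g : ℝ → ℝ}
    (hf : IsSpectralDensity f) (hg : IsSpectralDensity g) :
    ∀ᵐ t ∂freq, ‖smoother a f g t‖ ≤ ∑' k, ‖a k‖ := by
  filter_upwards [hf.nonneg, hg.nonneg] with t h1 h2
  have h3 := ratio_mem_Icc h1 h2
  rw [smoother, norm_mul, Complex.norm_real, Real.norm_of_nonneg h3.1]
  exact (mul_le_of_le_one_right (norm_nonneg _) h3.2).trans (norm_symbolA_le ha t)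

lemma memLp_smoother {a : ℕ → ℂ} (ha : AdmissibleCoeffs a) {f g : ℝ → ℝ}
    (hf : IsSpectralDensity f) (hg : IsSpectralDensity g) :
    MemLp (smoother a f g) 2 (specMeasure (f + g)) := by
  have := isFiniteMeasure_specMeasure (hf.add hg)
  have hac := specMeasure_absolutelyContinuous (f + g)
  exact MemLp.of_bound ((aestronglyMeasurable_smoother ha hf hg).mono_ac hac) _
    (hac.ae_le (norm_smoother_le ha hf hg))

/-- The error of the optimal estimate from the whole trajectory. -/
def smoothingError (a : ℕ → ℂ) (f g : ℝ → ℝ) : ℝ≥0∞ :=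
  ∫⁻ t, ENNReal.ofReal (‖symbolA a t‖ ^ 2 * (f t * g t / (f t + g t)) / (2 * π)) ∂freq

/-- Completing the square in `h`. When `x + y = 0` both weights vanish and the convention `0 / 0 =
0` keeps the identity true. -/
lemma sq_norm_split (A h : ℂ) {x y : ℝ} (hx : 0 ≤ x) (hy : 0 ≤ y) :
    x * ‖A - h‖ ^ 2 + y * ‖h‖ ^ 2 = ‖A‖ ^ 2 * (x * y / (x + y))
      + (x + y) * ‖A * ((x / (x + y) : ℝ) : ℂ) - h‖ ^ 2 := by
  rcases (add_nonneg hx hy).eq_or_lt with h0 | h0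
  · have hx0 : x = 0 := by linarith
    have hy0 : y = 0 := by linarith
    simp [hx0, hy0]
  · simp only [← Complex.normSq_eq_norm_sq, Complex.normSq_apply, Complex.sub_re, Complex.sub_im,
      Complex.mul_re, Complex.mul_im, Complex.ofReal_re, Complex.ofReal_im]
    field_simp
    ring

/-- Only the second term depends on `h`, so minimizing the error over `L₂⁰(f + g)` means projecting
`smoother` onto it. -/
lemma mse_eq_smoothingError_add {a : ℕ → ℂ} (ha : AdmissibleCoeffs a) {f g : ℝ → ℝ}
    (hf : IsSpectralDensity f) (hg : IsSpectralDensity g) {h : ℝ → ℂ}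
    (hh : AEStronglyMeasurable h freq) :
    mse a h f g = smoothingError a f g
      + ∫⁻ t, ‖smoother a f g t - h t‖ₑ ^ 2 ∂specMeasure (f + g) := by
  have hA := (continuous_symbolA ha).aestronglyMeasurable (μ := freq)
  have hpi := Real.pi_pos
  rw [mse, lintegral_sq_specMeasure hf (F := fun t => symbolA a t - h t) (hA.sub hh), lintegral_sq_specMeasure hg hh,
    lintegral_sq_specMeasure (hf.add hg) (F := fun t => smoother a f g t - h t)
      ((aestronglyMeasurable_smoother ha hf hg).sub hh),
    smoothingError, ← lintegral_add_right', ← lintegral_add_right']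
  · refine lintegral_congr_ae ?_
    filter_upwards [hf.nonneg, hg.nonneg] with t h1 h2
    have h3 : 0 ≤ f t * g t / (f t + g t) := by positivity
    have h4 : 0 ≤ (f + g) t := add_nonneg h1 h2
    rw [← ENNReal.ofReal_add (by positivity) (by positivity),
      ← ENNReal.ofReal_add (by positivity) (by positivity)]
    congr 1
    have := sq_norm_split (symbolA a t) (h t) h1 h2
    simp only [Pi.add_apply, smoother] at this ⊢
    field_simp
    field_simp at this
    linarith
  · exact (((hf.add hg).aemeasurable.div_const _).mul
      (((aestronglyMeasurable_smoother ha hf hg).sub hh).norm.aemeasurable.pow_const 2)).ennreal_ofReal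
  · exact ((hg.aemeasurable.div_const _).mul
      (hh.norm.aemeasurable.pow_const 2)).ennreal_ofReal

/-! ### The space of the observations -/

lemma memLp_expo {w : ℝ → ℝ} (hw : IsSpectralDensity w) (n : ℤ) :
    MemLp (expo n) 2 (specMeasure w) := by
  have := isFiniteMeasure_specMeasure hw
  exact MemLp.of_bound (continuous_expo n).aestronglyMeasurable 1
    (Eventually.of_forall fun t => (norm_expo n t).le)

/-- The exponential `e^{-i k t}` as an element of `L₂(w)`. -/
def obsVec {w : ℝ → ℝ} (hw : IsSpectralDensity w) (k : ℕ) : Lp ℂ 2 (specMeasure w) :=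
  (memLp_expo hw (-(k : ℤ))).toLp _

/-- `L₂⁰(w)` as a subspace of `L₂(w)`. -/
def obsSpace {w : ℝ → ℝ} (hw : IsSpectralDensity w) : Submodule ℂ (Lp ℂ 2 (specMeasure w)) :=
  (Submodule.span ℂ (range (obsVec hw))).topologicalClosure

lemma trigPoly_add (x y : ℕ →₀ ℂ) : trigPoly (x + y) = trigPoly x + trigPoly y := by
  funext t
  exact Finsupp.sum_add_index' (by simp) (by intros; ring)

lemma toLp_trigPoly {w : ℝ → ℝ} (hw : IsSpectralDensity w) (x : ℕ →₀ ℂ) :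
    (memLp_trigPoly hw x).toLp _ = Finsupp.linearCombination ℂ (obsVec hw) x := by
  induction x using Finsupp.induction_linear with
  | zero =>
    have : trigPoly 0 = 0 := by funext t; simp [trigPoly]
    simp only [this, map_zero]
    exact MemLp.toLp_zero _
  | add x y hx hy =>
    rw [map_add, ← hx, ← hy, ← MemLp.toLp_add]
    simp only [trigPoly_add]
  | single k z =>
    have : trigPoly (Finsupp.single k z) = z • expo (-(k : ℤ)) := by funext t; simp [trigPoly]
    rw [Finsupp.linearCombination_single, obsVec, ← MemLp.toLp_const_smul]
    simp only [this]

/-- Translation from functions to a closed subspace of a Hilbert space, where orthogonal projections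
are available. -/
lemma memL20_iff {f g : ℝ → ℝ} (hw : IsSpectralDensity (f + g)) {h : ℝ → ℂ} :
    MemL20 f g h ↔ ∃ hm : MemLp h 2 (specMeasure (f + g)), hm.toLp h ∈ obsSpace hw := by
  have key : ∀ hm : MemLp h 2 (specMeasure (f + g)), hm.toLp h ∈ obsSpace hw ↔
      ∀ ε : ℝ≥0∞, 0 < ε → ∃ x : ℕ →₀ ℂ,
        eLpNorm (fun t => h t - trigPoly x t) 2 (specMeasure (f + g)) < ε := by
    intro hm
    rw [obsSpace, ← SetLike.mem_coe, Submodule.topologicalClosure_coe, EMetric.mem_closure_iff]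
    refine forall₂_congr fun ε _ => ⟨?_, ?_⟩
    · rintro ⟨b, hb, hlt⟩
      obtain ⟨x, rfl⟩ := Finsupp.mem_span_range_iff_exists_finsupp.1 hb
      refine ⟨x, ?_⟩
      have h1 : (x.sum fun i a => a • obsVec hw i) = (memLp_trigPoly hw x).toLp _ :=
        (toLp_trigPoly hw x).symm
      rw [h1, Lp.edist_toLp_toLp] at hlt
      exact hlt
    · rintro ⟨x, hx⟩
      refine ⟨(memLp_trigPoly hw x).toLp _, ?_, ?_⟩
      · rw [toLp_trigPoly hw]
        exact Finsupp.mem_span_range_iff_exists_finsupp.2 ⟨x, rfl⟩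
      · rw [Lp.edist_toLp_toLp]
        exact hx
  exact ⟨fun H => ⟨H.memLp, (key _).2 H.approx⟩, fun ⟨hm, H⟩ => ⟨hm, (key hm).1 H⟩⟩

lemma inner_obsVec {w : ℝ → ℝ} (hw : IsSpectralDensity w) (k : ℕ) {ψ : ℝ → ℂ}
    (hψ : MemLp ψ 2 (specMeasure w)) :
    inner ℂ (obsVec hw k) (hψ.toLp ψ) = fourierCoef (fun t => ψ t * (w t : ℂ)) (-(k : ℤ)) := by
  rw [L2.inner_def]
  have h1 : (fun t => inner ℂ (obsVec hw k t) (hψ.toLp ψ t)) =ᵐ[specMeasure w]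
      fun t => ψ t * expo k t := by
    filter_upwards [(memLp_expo hw (-(k : ℤ))).coeFn_toLp, hψ.coeFn_toLp] with t h2 h3
    rw [h3, obsVec, h2, RCLike.inner_apply, conj_expo, neg_neg]
  rw [integral_congr_ae h1, integral_specMeasure hw, fourierCoef, neg_neg]
  congr 2
  funext t
  ring

lemma toLp_mem_orthogonal_iff {w : ℝ → ℝ} (hw : IsSpectralDensity w) {ψ : ℝ → ℂ}
    (hψ : MemLp ψ 2 (specMeasure w)) :
    hψ.toLp ψ ∈ (obsSpace hw)ᗮ ↔
      ∀ n : ℤ, n ≤ 0 → fourierCoef (fun t => ψ t * (w t : ℂ)) n = 0 := by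
  have h0 : hψ.toLp ψ ∈ (obsSpace hw)ᗮ ↔ ∀ k : ℕ, inner ℂ (obsVec hw k) (hψ.toLp ψ) = 0 := by
    rw [obsSpace, Submodule.orthogonal_closure, Submodule.mem_orthogonal]
    refine ⟨fun H k => H _ (Submodule.subset_span ⟨k, rfl⟩), fun H u hu => ?_⟩
    induction hu using Submodule.span_induction with
    | mem x hx => obtain ⟨k, rfl⟩ := hx; exact H k
    | zero => exact inner_zero_left _
    | add x y _ _ hx hy => rw [inner_add_left, hx, hy, add_zero]
    | smul c x _ hx => rw [inner_smul_left, hx, mul_zero]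
  simp only [h0, inner_obsVec]
  refine ⟨fun H n hn => ?_, fun H k => H _ (by omega)⟩
  have : n = -(n.natAbs : ℤ) := by omega
  rw [this]
  exact H _

/-- Under the minimality condition the elements of `L₂⁰(f + g)` have no positive frequencies. -/
lemma MemL20.fourierCoef_eq_zero {f g : ℝ → ℝ} (hf : IsSpectralDensity f)
    (hg : IsSpectralDensity g) (hmin : Minimality f g) {h : ℝ → ℂ} (hh : MemL20 f g h)
    {n : ℤ} (hn : 1 ≤ n) : fourierCoef h n = 0 := by
  have hw := hf.add hg
  obtain ⟨hm, hmem⟩ := (memL20_iff hw).1 hh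
  -- Minimality puts `e` in `L₂(f + g)`. Times the weight it is the single exponential of frequency
  -- `n ≥ 1`, so `e` is orthogonal to the observations; its inner product with `h` is the `n`-th
  -- Fourier coefficient of `h`.
  let e : ℝ → ℂ := fun t => expo n t / ((f t + g t : ℝ) : ℂ)
  have hpos := hmin.pos hf hg
  have heM : AEStronglyMeasurable e freq :=
    ((continuous_expo n).measurable.aemeasurable.div
      (Complex.measurable_ofReal.comp_aemeasurable hw.aemeasurable)).aestronglyMeasurable
  have he : MemLp e 2 (specMeasure (f + g)) := by
    rw [memLp_specMeasure_iff hw heM]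
    refine (hmin.integrable hf hg).congr ?_
    filter_upwards [hpos] with t ht
    simp only [e, norm_div, norm_expo, Complex.norm_real, Real.norm_of_nonneg ht.le, Pi.add_apply]
    field_simp
  have horth : he.toLp e ∈ (obsSpace hw)ᗮ := by
    rw [toLp_mem_orthogonal_iff]
    intro m hm
    have h1 : (fun t => e t * (((f + g) t : ℝ) : ℂ)) =ᵐ[freq] expo n := by
      filter_upwards [hpos] with t ht
      exact div_mul_cancel₀ _ (by exact_mod_cast ht.ne')
    rw [fourierCoef_congr h1, fourierCoef_expo, if_neg (by omega)]
  have h2 := Submodule.inner_left_of_mem_orthogonal hmem horth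
  rw [L2.inner_def] at h2
  have h3 : (fun t => inner ℂ (he.toLp e t) (hm.toLp h t)) =ᵐ[specMeasure (f + g)]
      fun t => h t * conj (e t) := by
    filter_upwards [he.coeFn_toLp, hm.coeFn_toLp] with t h4 h5
    rw [h4, h5, RCLike.inner_apply]
  rw [integral_congr_ae h3, integral_specMeasure hw] at h2
  rw [← h2, fourierCoef]
  congr 1
  refine integral_congr_ae ?_
  filter_upwards [hpos] with t ht
  have ht' : ((f t + g t : ℝ) : ℂ) ≠ 0 := by exact_mod_cast ht.ne'
  simp only [e, map_div₀, conj_expo, Complex.conj_ofReal, Pi.add_apply]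
  field_simp

/-! ### The operators and the spectral characteristic -/

lemma integrable_ratio {f g : ℝ → ℝ} (hf : IsSpectralDensity f) (hg : IsSpectralDensity g) :
    Integrable (fun t => ((f t / (f t + g t) : ℝ) : ℂ)) freq := by
  refine Integrable.of_bound (Complex.measurable_ofReal.comp_aemeasurable
      (hf.aemeasurable.div (hf.add hg).aemeasurable)).aestronglyMeasurable 1 ?_
  filter_upwards [hf.nonneg, hg.nonneg] with t h1 h2
  have h3 := ratio_mem_Icc h1 h2
  rw [Complex.norm_real, Real.norm_of_nonneg h3.1]
  exact h3.2

lemma integrable_smoother {a : ℕ → ℂ} (ha : AdmissibleCoeffs a) {f g : ℝ → ℝ}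
    (hf : IsSpectralDensity f) (hg : IsSpectralDensity g) : Integrable (smoother a f g) freq :=
  Integrable.of_bound (aestronglyMeasurable_smoother ha hf hg) _ (norm_smoother_le ha hf hg)

/-- `(R a)_l` is the Fourier coefficient of `A f / (f + g)` at `l + 1`. -/
lemma fourierCoef_smoother {a : ℕ → ℂ} (ha : AdmissibleCoeffs a) {f g : ℝ → ℝ}
    (hf : IsSpectralDensity f) (hg : IsSpectralDensity g) (l : ℕ) :
    fourierCoef (smoother a f g) ((l : ℤ) + 1) = vecR a f g l := by
  have h1 := (integral_mul_series (integrable_mul_expo (integrable_ratio hf hg)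
    (-((l : ℤ) + 1))) ha.summable_norm fun k => -(k : ℤ)).tsum_eq
  have h2 : ∀ m : ℕ, entryR f g (l + 1) m * a m = (1 / (2 * (π : ℂ))) * (a m *
      ∫ t, ((f t / (f t + g t) : ℝ) : ℂ) * expo (-((l : ℤ) + 1)) t * expo (-(m : ℤ)) t ∂freq) := by
    intro m
    rw [entryR, fourierCoef, mul_assoc, mul_comm (a m)]
    congr 3
    funext t
    have : -((m : ℤ) + (l + 1 : ℕ)) = -((l : ℤ) + 1) + -(m : ℤ) := by push_cast; ring
    rw [this, expo_add]; ring
  simp only [vecR, h2, tsum_mul_left, h1, fourierCoef]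
  congr 2
  funext t
  rw [smoother, symbolA]; ring

lemma integrable_harmonic {f g : ℝ → ℝ} (hf : IsSpectralDensity f) (hg : IsSpectralDensity g) :
    Integrable (fun t => f t * g t / (f t + g t)) freq := by
  refine hf.integrable.mono ((hf.aemeasurable.mul hg.aemeasurable).div
    (hf.add hg).aemeasurable).aestronglyMeasurable ?_
  filter_upwards [hf.nonneg, hg.nonneg] with t h1 h2
  rw [Real.norm_of_nonneg (by positivity), Real.norm_of_nonneg h1, mul_div_assoc]
  refine mul_le_of_le_one_right h1 ?_
  rw [add_comm]
  exact (ratio_mem_Icc h2 h1).2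

/-- `⟨Q a, a⟩` is the error of the optimal estimate from the whole trajectory. -/
lemma formQ_eq_integral {a : ℕ → ℂ} (ha : AdmissibleCoeffs a) {f g : ℝ → ℝ}
    (hf : IsSpectralDensity f) (hg : IsSpectralDensity g) :
    formQ a f g = ∫ t, ‖symbolA a t‖ ^ 2 * (f t * g t / (f t + g t)) / (2 * π) ∂freq := by
  have hq := (integrable_harmonic hf hg).ofReal (𝕜 := ℂ)
  simp only [Complex.coe_algebraMap] at hq
  have hqA : Integrable (fun t => ((f t * g t / (f t + g t) : ℝ) : ℂ) * symbolA a t) freq :=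
    hq.mul_bdd (continuous_symbolA ha).aestronglyMeasurable
      (Eventually.of_forall (norm_symbolA_le ha))
  have h1 : ∀ k : ℕ, (∑' j : ℕ, entryQ f g k j * a j) = (1 / (2 * (π : ℂ))) *
      ∫ t, ((f t * g t / (f t + g t) : ℝ) : ℂ) * symbolA a t * expo k t ∂freq := by
    intro k
    have h2 := (integral_mul_series (integrable_mul_expo hq k)
      ha.summable_norm fun k => -(k : ℤ)).tsum_eq
    have h3 : ∀ j : ℕ, entryQ f g k j * a j = (1 / (2 * (π : ℂ))) * (a j *
        ∫ t, ((f t * g t / (f t + g t) : ℝ) : ℂ) * expo k t * expo (-(j : ℤ)) t ∂freq) := by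
      intro j
      rw [entryQ, fourierCoef, mul_assoc, mul_comm (a j)]
      congr 3
      funext t
      have : -((j : ℤ) - k) = (k : ℤ) + -(j : ℤ) := by ring
      rw [this, expo_add]; ring
    simp only [h3, tsum_mul_left]
    rw [h2]
    congr 2
    funext t
    rw [symbolA]; ring
  have hc' : Summable fun k => ‖conj (a k)‖ := by simpa using ha.summable_norm
  have h4 := (integral_mul_series hqA hc' fun k => (k : ℤ)).tsum_eq
  have h5 : ∀ k : ℕ, (∑' j : ℕ, entryQ f g k j * a j) * conj (a k) = (1 / (2 * (π : ℂ))) *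
      (conj (a k) *
        ∫ t, ((f t * g t / (f t + g t) : ℝ) : ℂ) * symbolA a t * expo k t ∂freq) := by
    intro k
    rw [h1]; ring
  have h6 : ∀ t, ∑' k : ℕ, conj (a k) * expo k t = conj (symbolA a t) := by
    intro t
    rw [symbolA, Complex.conj_tsum]
    simp [conj_expo]
  simp only [formQ, h5, tsum_mul_left, h4, h6]
  rw [← integral_const_mul]
  have h7 : ∀ t, (1 / (2 * (π : ℂ))) *
      (((f t * g t / (f t + g t) : ℝ) : ℂ) * symbolA a t * conj (symbolA a t))
      = ((‖symbolA a t‖ ^ 2 * (f t * g t / (f t + g t)) / (2 * π) : ℝ) : ℂ) := by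
    intro t
    rw [mul_assoc, Complex.mul_conj, Complex.normSq_eq_norm_sq]
    push_cast; ring
  simp only [h7]
  rw [integral_complex_ofReal, Complex.ofReal_re]

lemma smoothingError_eq {a : ℕ → ℂ} (ha : AdmissibleCoeffs a) {f g : ℝ → ℝ}
    (hf : IsSpectralDensity f) (hg : IsSpectralDensity g) :
    smoothingError a f g = ENNReal.ofReal (formQ a f g) := by
  rw [formQ_eq_integral ha hf hg, smoothingError, ofReal_integral_eq_lintegral_ofReal]
  · refine Integrable.div_const ?_ _
    refine (integrable_harmonic hf hg).bdd_mul (c := (∑' k, ‖a k‖) ^ 2)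
      ((continuous_symbolA ha).norm.pow 2).aestronglyMeasurable (Eventually.of_forall fun t => ?_)
    rw [norm_pow, norm_norm]
    gcongr
    exact norm_symbolA_le ha t
  · filter_upwards [hf.nonneg, hg.nonneg] with t h1 h2
    have hpi := Real.pi_pos
    simp only [Pi.zero_apply]
    positivity

lemma formQ_nonneg {a : ℕ → ℂ} (ha : AdmissibleCoeffs a) {f g : ℝ → ℝ}
    (hf : IsSpectralDensity f) (hg : IsSpectralDensity g) : 0 ≤ formQ a f g := by
  rw [formQ_eq_integral ha hf hg]
  refine integral_nonneg_of_ae ?_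
  filter_upwards [hf.nonneg, hg.nonneg] with t h1 h2
  have hpi := Real.pi_pos
  simp only [Pi.zero_apply]
  positivity

lemma formP_nonneg {f g : ℝ → ℝ} (hf : IsSpectralDensity f) (hg : IsSpectralDensity g)
    (C : ℝ → ℂ) : 0 ≤ formP f g C := by
  have hpi := Real.pi_pos
  refine mul_nonneg (by positivity) (integral_nonneg_of_ae ?_)
  filter_upwards [hf.nonneg, hg.nonneg] with t h1 h2
  simp only [Pi.zero_apply]
  positivity

lemma aestronglyMeasurable_characteristic {a : ℕ → ℂ} (ha : AdmissibleCoeffs a) {f g : ℝ → ℝ}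
    (hf : IsSpectralDensity f) (hg : IsSpectralDensity g) {C : ℝ → ℂ}
    (hC : AEStronglyMeasurable C freq) :
    AEStronglyMeasurable (characteristic a f g C) freq :=
  (aestronglyMeasurable_smoother ha hf hg).sub (hC.aemeasurable.div
    (Complex.measurable_ofReal.comp_aemeasurable (hf.add hg).aemeasurable)).aestronglyMeasurable

lemma smoother_sub_characteristic (a : ℕ → ℂ) (f g : ℝ → ℝ) (C : ℝ → ℂ) (t : ℝ) :
    smoother a f g t - characteristic a f g C t = C t / ((f t + g t : ℝ) : ℂ) := by
  rw [smoother, characteristic, sub_sub_cancel]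

/-! ### Optimality of `h(f, g)` and existence of `P⁻¹ R a` -/

section InverseImage

variable {a : ℕ → ℂ} {f g : ℝ → ℝ} {c : ℕ → ℂ} {C : ℝ → ℂ}

/-- The error of `h(f, g)` is `⟨R a, P⁻¹ R a⟩ + ⟨Q a, a⟩`. -/
lemma IsInverseImageP.mse_characteristic (ha : AdmissibleCoeffs a)
    (hf : IsSpectralDensity f) (hg : IsSpectralDensity g) (hmin : Minimality f g)
    (hC : IsInverseImageP f g (vecR a f g) c C) :
    mse a (characteristic a f g C) f g = ENNReal.ofReal (errorValue a f g C) := by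
  have hCm := hC.series.integrable.aestronglyMeasurable
  rw [mse_eq_smoothingError_add ha hf hg (aestronglyMeasurable_characteristic ha hf hg hCm),
    smoothingError_eq ha hf hg, errorValue, add_comm (formP f g C),
    ENNReal.ofReal_add (formQ_nonneg ha hf hg) (formP_nonneg hf hg C)]
  congr 1
  simp only [smoother_sub_characteristic]
  rw [lintegral_sq_specMeasure (hf.add hg) (F := fun t => C t / ((f t + g t : ℝ) : ℂ))
    (hCm.aemeasurable.div
    (Complex.measurable_ofReal.comp_aemeasurable (hf.add hg).aemeasurable)).aestronglyMeasurable,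
    formP, ← integral_const_mul, ofReal_integral_eq_lintegral_ofReal (hC.energy.const_mul _)]
  · refine lintegral_congr_ae ?_
    filter_upwards [hmin.pos hf hg] with t ht
    congr 1
    simp only [norm_div, Complex.norm_real, Pi.add_apply,
      Real.norm_of_nonneg ht.le]
    field_simp
  · filter_upwards [hmin.pos hf hg] with t ht
    have hpi := Real.pi_pos
    simp only [Pi.zero_apply]
    positivity

/-- Positive frequencies are absent from the Fourier series of `h(f, g)`. -/
lemma IsInverseImageP.fourierCoef_characteristic (ha : AdmissibleCoeffs a)
    (hf : IsSpectralDensity f) (hg : IsSpectralDensity g)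
    (hC : IsInverseImageP f g (vecR a f g) c C)
    (hint : Integrable (characteristic a f g C) freq) {n : ℤ} (hn : 1 ≤ n) :
    fourierCoef (characteristic a f g C) n = 0 := by
  obtain ⟨l, rfl⟩ : ∃ l : ℕ, n = (l : ℤ) + 1 := ⟨(n - 1).toNat, by omega⟩
  have h1 := fourierCoef_smoother ha hf hg l
  rw [← hC.apply l] at h1
  have h2 : ∀ t, characteristic a f g C t
      = smoother a f g t - C t / ((f t + g t : ℝ) : ℂ) := fun t => rfl
  -- Needed to split the integral: `C / (f + g)` is the difference of two integrable functions.
  have hint2 : Integrable (fun t => C t / ((f t + g t : ℝ) : ℂ)) freq := by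
    refine ((integrable_smoother ha hf hg).sub hint).congr (Eventually.of_forall fun t => ?_)
    exact smoother_sub_characteristic a f g C t
  simp only [fourierCoef] at h1 ⊢
  simp only [h2, sub_mul]
  rw [integral_sub (integrable_mul_expo (integrable_smoother ha hf hg) _)
    (integrable_mul_expo hint2 _), mul_sub, h1, sub_self]

/-- Pythagoras' theorem: the excess error of an estimate is its squared distance from
`h(f, g)`. -/
lemma IsInverseImageP.mse_eq_add (ha : AdmissibleCoeffs a)
    (hf : IsSpectralDensity f) (hg : IsSpectralDensity g) (hmin : Minimality f g)
    (hC : IsInverseImageP f g (vecR a f g) c C)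
    (hch : MemL20 f g (characteristic a f g C)) {h : ℝ → ℂ} (hh : MemL20 f g h) :
    mse a h f g = mse a (characteristic a f g C) f g
      + ∫⁻ t, ‖characteristic a f g C t - h t‖ₑ ^ 2 ∂specMeasure (f + g) := by
  have hw := hf.add hg
  have hac := hmin.absolutelyContinuous hf hg
  rw [mse_eq_smoothingError_add ha hf hg (hh.memLp.1.mono_ac hac),
    mse_eq_smoothingError_add ha hf hg (hch.memLp.1.mono_ac hac), add_assoc]
  congr 1
  have hS := memLp_smoother ha hf hg
  obtain ⟨hm, hmem⟩ := (memL20_iff hw).1 hh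
  obtain ⟨hcm, hcmem⟩ := (memL20_iff hw).1 hch
  -- The remainder is `C / (f + g)`; multiplied by the weight it is `C`, whose coefficients at `n ≤
  -- 0` vanish.
  have hperp : (hS.sub hcm).toLp _ ∈ (obsSpace hw)ᗮ := by
    rw [toLp_mem_orthogonal_iff]
    intro n hn
    rw [← hC.series.coef_nonpos n hn]
    refine fourierCoef_congr ?_ n
    filter_upwards [hmin.pos hf hg] with t ht
    simp only [Pi.sub_apply, smoother_sub_characteristic]
    exact div_mul_cancel₀ _ (by exact_mod_cast ht.ne')
  have hin : inner ℂ ((hS.sub hcm).toLp _) ((hcm.sub hm).toLp _) = 0 := by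
    refine Submodule.inner_left_of_mem_orthogonal (K := obsSpace hw) ?_ hperp
    rw [MemLp.toLp_sub hcm hm]
    exact Submodule.sub_mem _ hcmem hmem
  have hpy := norm_add_sq_eq_norm_sq_add_norm_sq_of_inner_eq_zero _ _ hin
  rw [← MemLp.toLp_add] at hpy
  have hn : ∀ {F : ℝ → ℂ} (hF : MemLp F 2 (specMeasure (f + g))),
      ∫⁻ t, ‖F t‖ₑ ^ 2 ∂specMeasure (f + g) = ENNReal.ofReal (‖hF.toLp F‖ * ‖hF.toLp F‖) := by
    intro F hF
    rw [← eLpNorm_two_sq, Lp.norm_toLp, ← sq, ENNReal.ofReal_pow ENNReal.toReal_nonneg,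
      ENNReal.ofReal_toReal hF.2.ne]
  have e1 := hn ((hS.sub hcm).add (hcm.sub hm))
  rw [hpy, ENNReal.ofReal_add (by positivity) (by positivity), ← hn, ← hn] at e1
  simpa using e1

lemma IsInverseImageP.isOptimalCharacteristic (ha : AdmissibleCoeffs a)
    (hf : IsSpectralDensity f) (hg : IsSpectralDensity g) (hmin : Minimality f g)
    (hC : IsInverseImageP f g (vecR a f g) c C)
    (hch : MemL20 f g (characteristic a f g C)) :
    IsOptimalCharacteristic a f g (characteristic a f g C) := by
  refine ⟨hch, le_antisymm (le_iInf₂ fun h hh => ?_) (iInf₂_le _ hch)⟩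
  rw [hC.mse_eq_add ha hf hg hmin hch hh]
  exact le_self_add

end InverseImage

/-- Under the minimality condition `P⁻¹ R a` exists, and `h(f, g)` belongs to `L₂⁰(f + g)`. -/
lemma exists_isInverseImageP {a : ℕ → ℂ} (ha : AdmissibleCoeffs a) {f g : ℝ → ℝ}
    (hf : IsSpectralDensity f) (hg : IsSpectralDensity g) (hmin : Minimality f g) :
    ∃ c C, IsInverseImageP f g (vecR a f g) c C ∧ MemL20 f g (characteristic a f g C) := by
  have hw := hf.add hg
  have hpos := hmin.pos hf hg
  have hac := hmin.absolutelyContinuous hf hg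
  have := isFiniteMeasure_specMeasure hw
  have hS := memLp_smoother ha hf hg
  have : CompleteSpace (obsSpace hw) :=
    (Submodule.isClosed_topologicalClosure _).completeSpace_coe
  -- The projection `y` will be `h(f, g)` and the orthogonal part `z` will be `C / (f + g)`, which
  -- dictates the choice of `C` below.
  obtain ⟨y, hy, z, hz, hyz⟩ := (obsSpace hw).exists_add_mem_mem_orthogonal (hS.toLp _)
  have hy2 : MemLp y 2 (specMeasure (f + g)) := Lp.memLp y
  have hψ : MemLp (fun t => smoother a f g t - y t) 2 (specMeasure (f + g)) := hS.sub hy2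
  have hψz : hψ.toLp _ = z := by
    have : hψ.toLp _ = hS.toLp _ - hy2.toLp _ := MemLp.toLp_sub hS hy2
    rw [this, Lp.toLp_coeFn, hyz, add_sub_cancel_left]
  set ψ : ℝ → ℂ := fun t => smoother a f g t - y t with hψdef
  have hyL : MemL20 f g y := (memL20_iff hw).2 ⟨hy2, by rwa [Lp.toLp_coeFn]⟩
  let C : ℝ → ℂ := fun t => ψ t * (((f + g) t : ℝ) : ℂ)
  have hdiv : (fun t => C t / ((f t + g t : ℝ) : ℂ)) =ᵐ[freq] ψ := by
    filter_upwards [hpos] with t ht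
    exact mul_div_cancel_right₀ _ (by exact_mod_cast ht.ne')
  have hchar : characteristic a f g C =ᵐ[freq] y := by
    filter_upwards [hdiv] with t ht
    have h1 : characteristic a f g C t = smoother a f g t - C t / ((f t + g t : ℝ) : ℂ) := rfl
    rw [h1, ht, hψdef]
    simp
  have hch : MemL20 f g (characteristic a f g C) := by
    have h2 := (specMeasure_absolutelyContinuous (f + g)).ae_eq hchar
    refine ⟨hyL.memLp.ae_eq h2.symm, fun ε hε => ?_⟩
    obtain ⟨x, hx⟩ := hyL.approx ε hε
    refine ⟨x, lt_of_eq_of_lt (eLpNorm_congr_ae ?_) hx⟩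
    filter_upwards [h2] with t ht
    rw [ht]
  -- With `w = f + g`, `2 |F| ≤ w |F|² + 1 / w`, and minimality makes the right-hand side
  -- integrable.
  have hint : ∀ {F : ℝ → ℂ}, MemLp F 2 (specMeasure (f + g)) → Integrable F freq := by
    intro F hF
    have hFm := hF.1.mono_ac hac
    have h1 := (memLp_specMeasure_iff hw hFm).1 hF
    refine (h1.add (hmin.integrable hf hg)).mono' hFm ?_
    filter_upwards [hpos] with t ht
    simp only [Pi.add_apply]
    have h2 : 0 ≤ (1 - (f t + g t) * ‖F t‖) ^ 2 / (f t + g t) := by positivity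
    have h3 : (1 - (f t + g t) * ‖F t‖) ^ 2 / (f t + g t)
        = (f t + g t) * ‖F t‖ ^ 2 + 1 / (f t + g t) - 2 * ‖F t‖ := by
      field_simp; ring
    linarith [norm_nonneg (F t)]
  refine ⟨fun k => fourierCoef C ((k : ℤ) + 1), C, ⟨⟨?_, fun _ => rfl, ?_⟩, ?_, ?_⟩, hch⟩
  · have h1 := hψ.integrable (by norm_num)
    rw [specMeasure, integrable_withDensity_iff_integrable_smul₀' hw.aemeasurable_density
      (Eventually.of_forall fun _ => ENNReal.ofReal_lt_top)] at h1
    refine (h1.const_mul (2 * (π : ℂ))).congr ?_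
    filter_upwards [hw.nonneg] with t ht
    have hpi : (π : ℂ) ≠ 0 := by exact_mod_cast Real.pi_ne_zero
    have hpi' := Real.pi_pos
    rw [ENNReal.toReal_ofReal (div_nonneg ht (by positivity)), Complex.real_smul]
    simp only [C]
    push_cast
    field_simp
  -- Orthogonality of `z` says that `C` has only positive frequencies; below, `y ∈ L₂⁰(f + g)`
  -- yields `P c = R a`.
  · exact (toLp_mem_orthogonal_iff hw hψ).1 (hψz ▸ hz)
  · refine ((memLp_specMeasure_iff hw (hψ.1.mono_ac hac)).1 hψ).congr ?_
    filter_upwards [hpos] with t ht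
    simp only [C, norm_mul, Complex.norm_real, Pi.add_apply, Real.norm_of_nonneg ht.le]
    field_simp
  · intro l
    rw [fourierCoef_congr hdiv, ← fourierCoef_smoother ha hf hg]
    have h1 := hyL.fourierCoef_eq_zero hf hg hmin (n := (l : ℤ) + 1) (by omega)
    have h2 : fourierCoef ψ ((l : ℤ) + 1) = fourierCoef (smoother a f g) ((l : ℤ) + 1)
        - fourierCoef y ((l : ℤ) + 1) := by
      simp only [fourierCoef, hψdef, sub_mul]
      rw [integral_sub (integrable_mul_expo (integrable_smoother ha hf hg) _)
        (integrable_mul_expo (hint hy2) _), mul_sub]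
    rw [h2, h1, sub_zero]

/-! ### The saddle point -/

/-- A smaller density gives a weaker norm. Thus the optimal characteristic of a pair with added
noise competes at the original pair. -/
lemma MemL20.mono {f g f' g' : ℝ → ℝ} (hle : ∀ᵐ t ∂freq, f t + g t ≤ f' t + g' t) {h : ℝ → ℂ}
    (hh : MemL20 f' g' h) : MemL20 f g h := by
  have := specMeasure_le (f := f + g) (g := f' + g') hle
  refine ⟨hh.memLp.mono_measure this, fun ε hε => ?_⟩
  obtain ⟨x, hx⟩ := hh.approx ε hε
  exact ⟨x, (eLpNorm_mono_measure _ this).trans_lt hx⟩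

lemma Minimality.mono {f g f' g' : ℝ → ℝ} (hle : ∀ᵐ t ∂freq, f t + g t ≤ f' t + g' t)
    (h : Minimality f g) : Minimality f' g' := by
  refine lt_of_le_of_lt (lintegral_mono_ae ?_) h
  filter_upwards [hle] with t ht
  gcongr

lemma isSpectralDensity_const {u : ℝ} (hu : 0 ≤ u) : IsSpectralDensity fun _ => u :=
  ⟨integrable_const u, Eventually.of_forall fun _ => hu⟩

lemma integral_const_freq (u : ℝ) : (1 / (2 * π)) * ∫ _, u ∂freq = u := by
  have hpi := Real.pi_pos
  rw [integral_const, smul_eq_mul, freq, measureReal_restrict_apply_univ, Real.volume_real_Ioc_of_le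
    (by linarith)]
  field_simp
  ring

lemma specMeasure_add_const {f : ℝ → ℝ} (hf : IsSpectralDensity f) {u : ℝ} (hu : 0 ≤ u) :
    specMeasure (f + fun _ => u) = specMeasure f + specMeasure fun _ => u := by
  have hpi := Real.pi_pos
  rw [specMeasure, specMeasure, specMeasure, ← withDensity_add_right _ measurable_const]
  refine withDensity_congr_ae ?_
  filter_upwards [hf.nonneg] with t ht
  simp only [Pi.add_apply]
  rw [← ENNReal.ofReal_add (by positivity) (by positivity), add_div]

lemma mse_add_const (a : ℕ → ℂ) (h : ℝ → ℂ) {f g : ℝ → ℝ} (hf : IsSpectralDensity f)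
    (hg : IsSpectralDensity g) {u v : ℝ} (hu : 0 ≤ u) (hv : 0 ≤ v) :
    mse a h (f + fun _ => u) (g + fun _ => v)
      = mse a h f g + mse a h (fun _ => u) (fun _ => v) := by
  simp only [mse, specMeasure_add_const hf hu, specMeasure_add_const hg hv,
    lintegral_add_measure]
  ring

lemma mse_congr (a : ℕ → ℂ) {h h' : ℝ → ℂ} (H : h =ᵐ[freq] h') (f g : ℝ → ℝ) :
    mse a h f g = mse a h' f g := by
  unfold mse
  congr 1
  · refine lintegral_congr_ae ?_
    filter_upwards [(specMeasure_absolutelyContinuous f).ae_eq H] with t ht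
    rw [ht]
  · refine lintegral_congr_ae ?_
    filter_upwards [(specMeasure_absolutelyContinuous g).ae_eq H] with t ht
    rw [ht]

lemma lintegral_sq_specMeasure_of_norm_eq {f : ℝ → ℝ} (hf : IsSpectralDensity f) {F : ℝ → ℂ}
    {α : ℝ} (hα : ∀ᵐ t ∂freq, ‖F t‖ = α) :
    ∫⁻ t, ‖F t‖ₑ ^ 2 ∂specMeasure f
      = ENNReal.ofReal (α ^ 2 * ((1 / (2 * π)) * ∫ t, f t ∂freq)) := by
  have hpi := Real.pi_pos
  have h1 : ∫⁻ t, ‖F t‖ₑ ^ 2 ∂specMeasure f = ∫⁻ _, ENNReal.ofReal (α ^ 2) ∂specMeasure f := by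
    refine lintegral_congr_ae ?_
    filter_upwards [(specMeasure_absolutelyContinuous f).ae_le hα] with t ht
    rw [← ht, ENNReal.ofReal_pow (norm_nonneg _), ofReal_norm]
  rw [h1, lintegral_specMeasure hf aemeasurable_const, lintegral_mul_const'' _
    hf.aemeasurable_density, ← ofReal_integral_eq_lintegral_ofReal (hf.integrable.div_const _),
    ← ENNReal.ofReal_mul' (by positivity), integral_div]
  · congr 1; ring
  · filter_upwards [hf.nonneg] with t ht
    simp only [Pi.zero_apply]
    positivity

/-- An estimate for which `|A - h|` and `|h|` are constant has an error that depends only on the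
powers of the densities. -/
lemma mse_of_norm_eq {a : ℕ → ℂ} {h : ℝ → ℂ} {α β : ℝ}
    (hα : ∀ᵐ t ∂freq, ‖symbolA a t - h t‖ = α) (hβ : ∀ᵐ t ∂freq, ‖h t‖ = β)
    {f g : ℝ → ℝ} (hf : IsSpectralDensity f) (hg : IsSpectralDensity g) :
    mse a h f g = ENNReal.ofReal (α ^ 2 * ((1 / (2 * π)) * ∫ t, f t ∂freq)
      + β ^ 2 * ((1 / (2 * π)) * ∫ t, g t ∂freq)) := by
  have hpi := Real.pi_pos
  rw [mse, lintegral_sq_specMeasure_of_norm_eq hf hα, lintegral_sq_specMeasure_of_norm_eq hg hβ,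
    ENNReal.ofReal_add]
  · have := integral_nonneg_of_ae hf.nonneg
    positivity
  · have := integral_nonneg_of_ae hg.nonneg
    positivity

/-- If adding white noise to both sequences does not increase the error of the optimal estimate,
then the white noises contribute nothing to the error of `h(f, g)`. -/
lemma mse_const_eq_zero {a : ℕ → ℂ} (ha : AdmissibleCoeffs a) {f g : ℝ → ℝ}
    (hf : IsSpectralDensity f) (hg : IsSpectralDensity g) (hmin : Minimality f g)
    {c : ℕ → ℂ} {C : ℝ → ℂ} (hC : IsInverseImageP f g (vecR a f g) c C)
    (hch : MemL20 f g (characteristic a f g C)) {u v : ℝ} (hu : 0 ≤ u) (hv : 0 ≤ v)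
    (hmax : ∀ c' C', IsInverseImageP (f + fun _ => u) (g + fun _ => v)
      (vecR a (f + fun _ => u) (g + fun _ => v)) c' C' →
      errorValue a (f + fun _ => u) (g + fun _ => v) C' ≤ errorValue a f g C) :
    mse a (characteristic a f g C) (fun _ => u) (fun _ => v) = 0 := by
  have hfu := hf.add (isSpectralDensity_const hu)
  have hgv := hg.add (isSpectralDensity_const hv)
  have hle : ∀ᵐ t ∂freq, f t + g t ≤ f t + u + (g t + v) :=
    Eventually.of_forall fun t => by linarith
  have hmin' : Minimality (f + fun _ => u) (g + fun _ => v) := hmin.mono hle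
  obtain ⟨c', C', hC', hch'⟩ := exists_isInverseImageP ha hfu hgv hmin'
  set h := characteristic a f g C with hdef
  set h' := characteristic a (f + fun _ => u) (g + fun _ => v) C' with hdef'
  have h1 := ENNReal.ofReal_le_ofReal (hmax c' C' hC')
  -- The error of `h'` at the noisy pair is split by additivity in the densities, and its error at
  -- `(f, g)` by Pythagoras' theorem around `h`.
  rw [← hC'.mse_characteristic ha hfu hgv hmin', ← hC.mse_characteristic ha hf hg hmin,
    ← hdef, ← hdef', mse_add_const a h' hf hg hu hv,
    hC.mse_eq_add ha hf hg hmin hch (hch'.mono hle), ← hdef, add_assoc] at h1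
  have hfin : mse a h f g ≠ ⊤ := by
    rw [hdef, hC.mse_characteristic ha hf hg hmin]
    exact ENNReal.ofReal_ne_top
  have h2 : ∫⁻ t, ‖h t - h' t‖ₑ ^ 2 ∂specMeasure (f + g)
      + mse a h' (fun _ => u) (fun _ => v) = 0 := by
    by_contra hne
    exact (ENNReal.lt_add_right hfin hne).not_ge h1
  rw [add_eq_zero] at h2
  have hac := hmin.absolutelyContinuous hf hg
  -- The distance vanishes in `L₂(f + g)`, and minimality carries the equality over to Lebesgue
  -- measure; the noise error of `h'` is then that of `h`.
  have heq : h =ᵐ[freq] h' := by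
    have h3 := (lintegral_eq_zero_iff' (((hch.memLp.1.sub
      (hch'.mono hle).memLp.1).enorm).pow_const 2)).1 h2.1
    filter_upwards [hac.ae_le h3] with t ht
    simpa [sub_eq_zero] using ht
  rw [mse_congr a heq]
  exact h2.2

end RobustFiltering

end

/-! ### The saddle point and its consequences -/

theorem mainTheorem6 (a : ℕ → ℂ) (ha : AdmissibleCoeffs a)
    (P₁ P₂ : ℝ) (f₀ g₀ : ℝ → ℝ)
    (hf₀ : f₀ ∈ powerClass P₁) (hg₀ : g₀ ∈ powerClass P₂)
    (hmin : Minimality f₀ g₀)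
    -- `c₀ = P₀⁻¹ R₀ a` and `C₀(t) = ∑ c₀(k) e^{i t (k+1)}`
    (c₀ : ℕ → ℂ) (C₀ : ℝ → ℂ)
    (hC₀ : IsInverseImageP f₀ g₀ (vecR a f₀ g₀) c₀ C₀)
    (hf_bdd : ∃ M : ℝ, ∀ᵐ t ∂freq, hf a f₀ g₀ C₀ t ≤ M)
    (hg_bdd : ∃ M : ℝ, ∀ᵐ t ∂freq, hg a f₀ g₀ C₀ t ≤ M)
    (α₁ α₂ : ℝ) (hα₁ : 0 ≤ α₁) (hα₂ : 0 ≤ α₂)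
    (heq₁ : ∀ᵐ t ∂freq,
      ‖symbolA a t * (g₀ t : ℂ) + C₀ t‖ = α₁ * (f₀ t + g₀ t))
    (heq₂ : ∀ᵐ t ∂freq,
      ‖symbolA a t * (f₀ t : ℂ) - C₀ t‖ = α₂ * (f₀ t + g₀ t))
    (hmax : SolvesMaximization a
      (powerClass P₁ ×ˢ powerClass P₂) f₀ g₀ C₀) :
    IsLeastFavorable a
      (powerClass P₁ ×ˢ powerClass P₂) f₀ g₀ ∧
    IsOptimalCharacteristic a f₀ g₀
      (characteristic a f₀ g₀ C₀) ∧
    IsMinimaxRobust a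
      (powerClass P₁ ×ˢ powerClass P₂)
      (characteristic a f₀ g₀ C₀) := by
  obtain ⟨hf₀, hp₁⟩ := hf₀
  obtain ⟨hg₀, hp₂⟩ := hg₀
  have hpos := hmin.pos hf₀ hg₀
  set h := characteristic a f₀ g₀ C₀ with hdef
  have hα : ∀ᵐ t ∂freq, ‖symbolA a t - h t‖ = α₁ := by
    filter_upwards [hpos, heq₁] with t ht h1
    have ht' : ((f₀ t + g₀ t : ℝ) : ℂ) ≠ 0 := by exact_mod_cast ht.ne'
    have h2 : symbolA a t - h t
        = (symbolA a t * (g₀ t : ℂ) + C₀ t) / ((f₀ t + g₀ t : ℝ) : ℂ) := by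
      rw [hdef, characteristic, Complex.ofReal_div]
      field_simp
      push_cast
      ring
    rw [h2, norm_div, h1, Complex.norm_real, Real.norm_of_nonneg ht.le]
    field_simp
  have hβ : ∀ᵐ t ∂freq, ‖h t‖ = α₂ := by
    filter_upwards [hpos, heq₂] with t ht h1
    have ht' : ((f₀ t + g₀ t : ℝ) : ℂ) ≠ 0 := by exact_mod_cast ht.ne'
    have h2 : h t = (symbolA a t * (f₀ t : ℂ) - C₀ t) / ((f₀ t + g₀ t : ℝ) : ℂ) := by
      rw [hdef, characteristic, Complex.ofReal_div]
      field_simp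
    rw [h2, norm_div, h1, Complex.norm_real, Real.norm_of_nonneg ht.le]
    field_simp
  have hm := aestronglyMeasurable_characteristic ha hf₀ hg₀ hC₀.series.integrable.1
  have hint : Integrable h freq := Integrable.of_bound hm α₂ (hβ.mono fun t ht => ht.le)
  have hL20 : ∀ {f g : ℝ → ℝ}, IsSpectralDensity f → IsSpectralDensity g → MemL20 f g h :=
    fun hf hg => memL20_of_bounded hf hg hm (hβ.mono fun t ht => ht.le)
      fun n hn => hC₀.fourierCoef_characteristic ha hf₀ hg₀ hint hn
  have hopt := hC₀.isOptimalCharacteristic ha hf₀ hg₀ hmin (hL20 hf₀ hg₀)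
  -- Complementary slackness. Each bracket is nonnegative, so a power constraint with nonzero `αᵢ`
  -- is saturated.
  have hzero : α₁ ^ 2 * (P₁ - (1 / (2 * π)) * ∫ t, f₀ t ∂freq)
      + α₂ ^ 2 * (P₂ - (1 / (2 * π)) * ∫ t, g₀ t ∂freq) ≤ 0 := by
    have hu := sub_nonneg.2 hp₁
    have hv := sub_nonneg.2 hp₂
    -- White noise whose level is the unused power brings the total power to exactly `p`.
    have hpower : ∀ {f : ℝ → ℝ} {p : ℝ}, IsSpectralDensity f →
        0 ≤ p - (1 / (2 * π)) * ∫ t, f t ∂freq →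
        (f + fun _ => p - (1 / (2 * π)) * ∫ t, f t ∂freq) ∈ powerClass p := by
      intro f p hf hp
      refine ⟨hf.add (isSpectralDensity_const hp), ?_⟩
      have h1 := integral_add hf.integrable
        (integrable_const (μ := freq) (p - (1 / (2 * π)) * ∫ t, f t ∂freq))
      simp only [Pi.add_apply]
      rw [h1, mul_add, integral_const_freq, add_sub_cancel]
    have h0 := mse_const_eq_zero ha hf₀ hg₀ hmin hC₀ (hL20 hf₀ hg₀) hu hv
      fun c' C' hC' => hmax.2 _ _ ⟨hpower hf₀ hu, hpower hg₀ hv⟩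
        (hmin.mono (Eventually.of_forall fun t => by simp only [Pi.add_apply]; linarith)) c' C' hC'
    rw [← hdef, mse_of_norm_eq hα hβ (isSpectralDensity_const hu) (isSpectralDensity_const hv),
      integral_const_freq, integral_const_freq] at h0
    exact ENNReal.ofReal_eq_zero.1 h0
  have hsaddle : ∀ f g : ℝ → ℝ, (f, g) ∈ powerClass P₁ ×ˢ powerClass P₂ →
      mse a h f g ≤ mse a h f₀ g₀ := by
    rintro f g ⟨⟨hf, hpf⟩, ⟨hg, hpg⟩⟩
    rw [mse_of_norm_eq hα hβ hf hg, mse_of_norm_eq hα hβ hf₀ hg₀]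
    refine ENNReal.ofReal_le_ofReal ?_
    have h1 := mul_le_mul_of_nonneg_left hpf (sq_nonneg α₁)
    have h2 := mul_le_mul_of_nonneg_left hpg (sq_nonneg α₂)
    linarith
  refine ⟨⟨⟨⟨hf₀, hp₁⟩, ⟨hg₀, hp₂⟩⟩, fun f g hfg => ?_⟩, hopt, fun f g hfg => ?_, fun h' hh' => ?_⟩
  -- `Δ(f, g) ≤ Δ(h; f, g) ≤ Δ(h; f₀, g₀) = Δ(f₀, g₀)`. As `h` lies in every `L₂⁰(f + g)`, pairs
  -- that violate the minimality condition are covered too.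
  · rw [← hopt.2]
    exact (iInf₂_le h (hL20 hfg.1.1 hfg.2.1)).trans (hsaddle f g hfg)
  · exact hL20 hfg.1.1 hfg.2.1
  · have hD : (f₀, g₀) ∈ powerClass P₁ ×ˢ powerClass P₂ := ⟨⟨hf₀, hp₁⟩, ⟨hg₀, hp₂⟩⟩
    -- The worst error of `h` is attained at `(f₀, g₀)`, where no admissible `h'` does better.
    refine iSup₂_le fun p hp => (hsaddle p.1 p.2 hp).trans ?_
    rw [hopt.2]
    exact (iInf₂_le h' (hh' f₀ g₀ hD)).trans
      (le_iSup₂ (f := fun p (_ : p ∈ powerClass P₁ ×ˢ powerClass P₂) => mse a h' p.1 p.2)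
        (f₀, g₀) hD)
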